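/- All graphs are finite and simple. For a graph $G$, let $K_G$ be the complete graph on the vertex set $V(G)$. A pairing of $G$ is a perfect matching of $K_G$. The graph $G$ has the Pairing-Hamiltonian property (PH-property) if it has even order and for every pairing $M$ of $G$ there is a perfect matching $N$ of $G$ such that $M\cup N$ is the edge set of a Hamiltonian cycle of $K_G$. The prism of $G$ is the Cartesian product $\mathcal P(G)=G\,\Box\,K_2$; put $\mathcal P^0(G)=G$ and $\mathcal P^k(G)=\mathcal P(\mathcal P^{k-1}(G))$ for $k\ge 1$. For a connected graph $G$, the minimum leaf number $\mathrm{ml}(G)$ is the minimum number of leaves (vertices of degree one) over all spanning trees of $G$. Theorem. Let $G$ be a connected graph and let $m=\mathrm{ml}(G)$. Then $\mathcal P^{m+3}(G)$ has the PH-property. -/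

import Mathlib

namespace PrismPH

open SimpleGraph

/-- The prism of `G`: the Cartesian product of `G` with `K₂`. -/
def prism {V : Type*} (G : SimpleGraph V) : SimpleGraph (V × Bool) :=
  G □ (⊤ : SimpleGraph Bool)

/-- The vertex set of the `k`-th iterated prism of a graph with vertex set `V`. -/
def IterPrismVertex (V : Type*) : ℕ → Type _
  | 0 => V
  | k + 1 => IterPrismVertex V k × Bool

/-- The `k`-th iterated prism of `G`: the prism operator applied `k` times to `G`. -/
def iterPrism {V : Type*} (G : SimpleGraph V) : (k : ℕ) → SimpleGraph (IterPrismVertex V k)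
  | 0 => G
  | k + 1 => prism (iterPrism G k)

/-- The number of leaves (vertices of degree one) of `T`. -/
noncomputable def numLeaves {V : Type*} (T : SimpleGraph V) : ℕ :=
  {v : V | (T.neighborSet v).ncard = 1}.ncard

/-- The minimum leaf number of `G`: the minimum number of leaves over all spanning trees of `G`.
A spanning tree of `G` is a tree on the same vertex type all of whose edges are edges of `G`. -/
noncomputable def minLeafNumber {V : Type*} (G : SimpleGraph V) : ℕ :=
  sInf {n : ℕ | ∃ T : SimpleGraph V, T ≤ G ∧ T.IsTree ∧ numLeaves T = n}

open Classical in
/-- The pairing `M`, a matching of the complete graph on the vertices of `G`, extends to a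
Hamiltonian cycle: some perfect matching `N` of `G` is such that `M ∪ N` is the edge set of a
Hamiltonian cycle of that complete graph. -/
def Extends {V : Type*} (G : SimpleGraph V) (M : (⊤ : SimpleGraph V).Subgraph) : Prop :=
  ∃ N : G.Subgraph, N.IsPerfectMatching ∧
    ∃ (v : V) (c : (⊤ : SimpleGraph V).Walk v v), c.IsHamiltonianCycle ∧
      M.edgeSet ∪ N.edgeSet = c.edgeSet

/-- The Pairing-Hamiltonian property: `G` has even order, and every pairing of `G` (a perfect
matching of the complete graph on its vertices) extends to a Hamiltonian cycle. -/
def IsPH {V : Type*} (G : SimpleGraph V) : Prop :=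
  Even (Nat.card V) ∧
    ∀ M : (⊤ : SimpleGraph V).Subgraph, M.IsPerfectMatching → Extends G M

end PrismPH

/-! The proof has two halves: `m` prisms make `G` traceable (`exists_isHamiltonianList_iterPrism`),
and three further prisms of a traceable graph give the PH-property
(`IsHamiltonianList.isPH_triple_prism`).

Traceability. A spanning tree with `m` leaves has maximum degree at most `m`, and for `m ≥ 2` the
Gray code gives the `m`-cube a Hamiltonian cycle of length `2 ^ m ≥ m + 2`. In the product of the
tree with this cycle, tree vertices are added one at a time: the fibre over a new vertex is
traversed as a detour replacing one edge of the path over its neighbour. The degree bound ensures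
that such an edge is always left. A one-vertex graph has `m = 0` and is trivial.

PH-property. A triple prism of a traceable graph contains a path times the 3-cube as a spanning
subgraph, and two perfect matchings form a Hamiltonian cycle once their union is connected and there
are more than two vertices. The argument is an induction on the length of the path
(`extendable_slab`). If some pair joins different fibres, the path is cut between them and the two
sides are treated in turn (`extends_of_crossing`): the components produced by the left side
prescribe a pairing of the right side.

If all pairs stay within fibres, a transfer argument applies. A state records which vertices of a
fibre use path edges ("rungs") to the left, and how the part on the left joins them. Reading fibres
from right to left, the states that can be completed always include, up to a cube automorphism, one
of five fixed families. This invariant is a finite check over the 105 pairings of the cube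
(`letters_last`, `letters_step`, `letters_start`). -/

namespace PrismPH

/-! ### A finite certificate for pairings of the three-dimensional cube

Self-maps of `{0, …, 7}` are coded by eight octal digits. -/

/-- The `x`-th octal digit of `c`. -/
def dig (c x : ℕ) : ℕ := Nat.land (Nat.shiftRight c (Nat.mul 3 x)) 7

/-- `x`, put into the octal digit `k`. -/
def put (x k : ℕ) : ℕ := Nat.shiftLeft x (Nat.mul 3 k)

/-- Evaluate the argument before applying the function. -/
def force {α : Type} (n : ℕ) (f : ℕ → α) : α := Nat.casesOn n (f 0) fun k => f (Nat.succ k)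

/-- Adjacency in the three-dimensional cube on `{0, …, 7}`. -/
def cubeAdj (x y : ℕ) : Bool := Nat.testBit 22 (Nat.xor x y)

/-- Conjunction over the vertices of the cube. -/
def all8 (p : ℕ → Bool) : Bool := p 0 && (p 1 && (p 2 && (p 3 && (p 4 && (p 5 && (p 6 && p 7))))))

/-- The vertices of the cube. -/
def octet : List ℕ := [0, 1, 2, 3, 4, 5, 6, 7]

/-- The code of the identity. -/
def idCode : ℕ := 0o76543210

/-- The sum of the values of `f` on the vertices of the cube. -/
def sum8 (f : ℕ → ℕ) : ℕ :=
  Nat.add (f 0) (Nat.add (f 1) (Nat.add (f 2) (Nat.add (f 3)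
    (Nat.add (f 4) (Nat.add (f 5) (Nat.add (f 6) (f 7)))))))

/-- The code of the conjugate of `s` by `g`. -/
def conjCode (g s : ℕ) : ℕ := sum8 fun x => put (dig g (dig s x)) (dig g x)

/-- Codes of all involutions without fixed points of the vertices in `l`. -/
def pairingCodes : ℕ → List ℕ → List ℕ
  | 0, _ => [0]
  | _ + 1, [] => [0]
  | k + 1, a :: l => l.flatMap fun b =>
      (pairingCodes k (l.erase b)).map fun c => b * 8 ^ a + a * 8 ^ b + c

/-- Does some perfect matching of the cube vertices in the list, added to `acc`, pass `chk`? -/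
def anyMatching (chk : ℕ → Bool) : ℕ → List ℕ → ℕ → Bool
  | 0, _, acc => force acc chk
  | _ + 1, [], acc => force acc chk
  | k + 1, a :: l, acc => l.any fun b =>
      cubeAdj a b && anyMatching chk k (l.filter fun y => !Nat.beq y b)
        (Nat.add (put b a) (Nat.add (put a b) acc))

/-- Is `x` fixed by `s`? -/
def fixes (s x : ℕ) : Bool := Nat.beq (dig s x) x

/-- Follow `M` and `t` alternately from `x` until a vertex moved by `s` is reached; record the
vertices visited as a bit mask. -/
def trace (M t s : ℕ) : ℕ → ℕ → ℕ → ℕ × ℕ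
  | 0, x, acc => (x, acc)
  | k + 1, x, acc =>
      force (dig M x) fun y => force (Nat.lor acc (Nat.lor (Nat.shiftLeft 1 x) (Nat.shiftLeft 1 y))) fun acc =>
      bif fixes s y then force (dig t y) fun z => trace M t s k z acc
      else (y, acc)

/-- `t` extends `s₀` by cube edges to an involution of the vertices fixed by `s₁`. -/
def compatible (s₀ s₁ t : ℕ) : Bool :=
  all8 fun x =>
    bif fixes s₁ x then
      fixes s₁ (dig t x) && (Nat.beq (dig t (dig t x)) x &&
        bif fixes s₀ x then cubeAdj x (dig t x) else Nat.beq (dig t x) (dig s₀ x))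
    else fixes s₀ x && Nat.beq (dig s₁ (dig s₁ x)) x

/-- The paths formed by `M` and `t` join the vertices moved by `s₁` as `s₁` does, and cover
everything. -/
def linked (M s₁ t : ℕ) : Bool :=
  -- Four steps suffice, each using one of the four edges of `M`; 255 is the mask of all eight
  -- vertices.
  (all8 fun x => fixes s₁ x || Nat.beq (trace M t s₁ 4 x 0).1 (dig s₁ x)) &&
  Nat.beq (octet.foldr (fun x acc => Nat.lor acc (bif fixes s₁ x then 0 else (trace M t s₁ 4 x 0).2)) 0) 255

/-- A vertex moved by `s₀` has a rung to the left, one moved by `s₁` a rung to the right; only the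
others need a cube edge. -/
def freeVertices (s₀ s₁ : ℕ) : List ℕ :=
  octet.filter fun x => fixes s₀ x && fixes s₁ x

/-- The zero digits are filled by addition in `anyMatching`. In `continues`, vertices moved by `s₁`
keep the digit 0, harmlessly: `t` is consulted only at fixed points of `s₁`. -/
def movedPart (s : ℕ) : ℕ := sum8 fun x => bif fixes s x then 0 else put (dig s x) x

/-- With pairing `M` on a fibre, state `s₀` on its left can be continued to state `s₁` on its
right. -/
def continues (M s₀ s₁ : ℕ) : Bool :=
  (all8 fun x => fixes s₀ x || fixes s₁ x) &&
  anyMatching (fun t => linked M s₁ t && compatible s₀ s₁ t) 4 (freeVertices s₀ s₁) (movedPart s₀)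

/-- With pairing `M` on the last fibre, state `s₀` on its left can be completed. -/
def completes (M s₀ : ℕ) : Bool :=
  -- Nothing is moved by `idCode`, so the trace never stops early: it follows the cycle through 0
  -- along four edges of `M`, and a full mask means that there is no other cycle.
  anyMatching (fun t => Nat.beq (trace M t idCode 4 0 0).2 255 && compatible s₀ idCode t) 4
    (freeVertices s₀ idCode) (movedPart s₀)

/-- Families of states; for every path of fibres all states of some family can be completed, up to
an automorphism of the cube. -/
def families : List (List ℕ) :=
  [[0o67543210, 0o74563210, 0o76541230, 0o74562310, 0o67541230],
   [0o76453210, 0o74563210, 0o36457210, 0o34567210],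
   [0o76453210, 0o74563210, 0o76534210],
   [0o76241530, 0o76134250, 0o56743210, 0o76534210, 0o76243510],
   [0o56734210, 0o56743210, 0o76542310, 0o56742310, 0o76534210]]

/-- Automorphisms of the cube, each with the index of a family. -/
def images : List (ℕ × ℕ) :=
  [(0o31207564, 2), (0o20316475, 2), (0o46570213, 2), (0o13025746, 2), (0o37261504, 2),
   (0o13570246, 4), (0o13025746, 4), (0o04261537, 4), (0o04152637, 4), (0o23016745, 4),
   (0o23670145, 4), (0o51407362, 2), (0o62407351, 2), (0o45016723, 4), (0o04261537, 1),
   (0o45670123, 4), (0o15370426, 1), (0o26370415, 1), (0o62407351, 1), (0o32107654, 3),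
   (0o31207564, 3), (0o23016745, 3), (0o45670123, 3), (0o10325476, 0), (0o57134602, 3),
   (0o64752031, 3), (0o54761032, 3), (0o46570213, 4), (0o37152604, 0), (0o46025713, 4),
   (0o01452367, 4), (0o37152604, 1), (0o26043715, 3), (0o76543210, 3), (0o20643175, 3),
   (0o40625173, 1), (0o23670145, 0)]

def isAutomorphism (g : ℕ) : Bool :=
  all8 fun x => all8 fun y =>
    (Nat.beq (dig g x) (dig g y) == Nat.beq x y) && cubeAdj (dig g x) (dig g y) == cubeAdj x y

def letters : List ℕ := pairingCodes 4 octet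

/-- One automorphism serves the whole family, since its states must be completable against the same
pairings of the fibres. -/
def someImage (p : ℕ → Bool) : Bool :=
  images.any fun gj => (families.getD gj.2 []).all fun s => force (conjCode gj.1 s) p

theorem images_automorphism : (images.all fun gj => isAutomorphism gj.1) = true := by
  decide +kernel

/-- The first fibre, with no rungs to the left: it can be completed alone, and any family available
on its right contains a usable state. -/
theorem letters_start :
    (letters.all fun M => completes M idCode &&
      families.all fun A => A.any fun s₁ => continues M idCode s₁) = true := by
  decide +kernel

/-- Base of the induction from the right end of the path. -/
theorem letters_last : (letters.all fun M => someImage (completes M)) = true := by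
  decide +kernel

/-- Inductive step: whichever family is available on the right of a fibre, an image of some family
becomes available on its left. -/
theorem letters_step :
    (letters.all fun M => families.all fun A =>
      someImage fun s₀ => A.any fun s₁ => continues M s₀ s₁) = true := by
  decide +kernel

/-! ### Soundness of the certificate -/

theorem force_eq {α : Type} (n : ℕ) (f : ℕ → α) : force n f = f n := by
  cases n <;> rfl

theorem natBeq_iff (a b : ℕ) : Nat.beq a b = true ↔ a = b :=
  ⟨Nat.eq_of_beq_eq_true, fun h => h ▸ Nat.beq_refl a⟩

theorem dig_eq (c x : ℕ) : dig c x = c / 8 ^ x % 8 := by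
  have h1 : Nat.land (Nat.shiftRight c (Nat.mul 3 x)) 7 = (c >>> (3 * x)) &&& (2 ^ 3 - 1) := rfl
  rw [dig, h1, Nat.and_two_pow_sub_one_eq_mod, Nat.shiftRight_eq_div_pow, pow_mul]
  norm_num

theorem dig_lt (c x : ℕ) : dig c x < 8 := by
  rw [dig_eq]; exact Nat.mod_lt _ (by norm_num)

theorem put_eq (x k : ℕ) : put x k = x * 8 ^ k := by
  have h1 : put x k = x <<< (3 * k) := rfl
  rw [h1, Nat.shiftLeft_eq, pow_mul]
  norm_num

/-- The self-map of the cube coded by `c`. -/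
def decode (c : ℕ) (x : Fin 8) : Fin 8 := ⟨dig c x, dig_lt c x⟩

/-- Adjacency in the three-dimensional cube. -/
def CubeAdj (x y : Fin 8) : Prop := cubeAdj x y = true

instance : DecidableRel CubeAdj := fun x y => inferInstanceAs (Decidable (cubeAdj x y = true))

theorem CubeAdj.ne {x y : Fin 8} (h : CubeAdj x y) : x ≠ y := by
  revert x y; decide +kernel

theorem all8_iff (p : ℕ → Bool) : all8 p = true ↔ ∀ x : Fin 8, p x = true := by
  simp [all8, Fin.forall_fin_succ]

theorem sum8_eq (f : ℕ → ℕ) : sum8 f = ∑ x : Fin 8, f x := by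
  simp only [Fin.sum_univ_eight]
  simp only [sum8, Nat.add_eq, ← add_assoc]
  rfl

theorem dig_sum (f : Fin 8 → ℕ) (hf : ∀ x, f x < 8) (z : Fin 8) :
    dig (∑ x : Fin 8, f x * 8 ^ (x : ℕ)) z = f z := by
  rw [dig_eq, Fin.sum_univ_eight]
  have h0 := hf 0
  have h1 := hf 1
  have h2 := hf 2
  have h3 := hf 3
  have h4 := hf 4
  have h5 := hf 5
  have h6 := hf 6
  have h7 := hf 7
  fin_cases z <;> simp <;> omega

theorem testBit_mask (x : Fin 8) : Nat.testBit 255 x = true := by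
  revert x; decide +kernel

theorem fixes_iff (s : ℕ) (x : Fin 8) : fixes s x = true ↔ decode s x = x := by
  simp [fixes, decode, Fin.ext_iff]

theorem decode_idCode (x : Fin 8) : decode idCode x = x := by
  revert x; decide +kernel

/-- Nothing about the enumeration has to be retained, because `chk` itself verifies that `t` is
suitable. -/
theorem anyMatching_sound {chk : ℕ → Bool} {k : ℕ} {l : List ℕ} {acc : ℕ}
    (h : anyMatching chk k l acc = true) : ∃ t, chk t = true := by
  induction k generalizing l acc with
  | zero => exact ⟨acc, by simpa [anyMatching, force_eq] using h⟩
  | succ k ih =>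
    cases l with
    | nil => exact ⟨acc, by simpa [anyMatching, force_eq] using h⟩
    | cons a l =>
      simp only [anyMatching, List.any_eq_true, Bool.and_eq_true] at h
      obtain ⟨b, -, -, h⟩ := h
      exact ih h

/-- Connectivity is expressed by predicates `P` that are constant along edges; each vertex visited
is reached from `x` along such edges. -/
theorem trace_sound {M t s : ℕ} {P : Fin 8 → Prop} (hM : ∀ x, P x ↔ P (decode M x))
    (ht : ∀ x, decode s x = x → (P x ↔ P (decode t x))) (k : ℕ) (x : Fin 8) (acc : ℕ) :
    (∃ y : Fin 8, (trace M t s k x acc).1 = y ∧ (P y ↔ P x)) ∧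
      ∀ i : Fin 8, (trace M t s k x acc).2.testBit i = true →
        acc.testBit i = true ∨ (P i ↔ P x) := by
  induction k generalizing x acc with
  | zero => exact ⟨⟨x, rfl, Iff.rfl⟩, fun i hi => Or.inl hi⟩
  | succ k ih =>
    have hbit : ∀ i : Fin 8, (Nat.lor acc (Nat.lor (Nat.shiftLeft 1 x)
        (Nat.shiftLeft 1 (decode M x)))).testBit i = true → acc.testBit i = true ∨ (P i ↔ P x) := by
      intro i hi
      have e : Nat.lor acc (Nat.lor (Nat.shiftLeft 1 x) (Nat.shiftLeft 1 (decode M x))) =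
        acc ||| (1 <<< (x : ℕ) ||| 1 <<< (decode M x : ℕ)) := rfl
      rw [e, Nat.testBit_or, Nat.testBit_or, Nat.one_shiftLeft, Nat.one_shiftLeft,
        Nat.testBit_two_pow, Nat.testBit_two_pow] at hi
      simp only [Bool.or_eq_true, decide_eq_true_eq] at hi
      rcases hi with hi | hi | hi
      · exact Or.inl hi
      · rw [Fin.ext hi.symm]; exact Or.inr Iff.rfl
      · rw [Fin.ext hi.symm]; exact Or.inr (hM x).symm
    have hdig : dig M x = decode M x := rfl
    simp only [trace, force_eq, hdig]
    cases hfix : fixes s (decode M x) with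
    | false =>
      simp only [cond_false]
      exact ⟨⟨_, rfl, (hM x).symm⟩, hbit⟩
    | true =>
      have hs := (fixes_iff _ _).1 hfix
      have hz : dig t (decode M x) = decode t (decode M x) := rfl
      simp only [cond_true, hz]
      have hP : P (decode t (decode M x)) ↔ P x := (ht _ hs).symm.trans (hM x).symm
      obtain ⟨⟨y, hy, hy'⟩, h2⟩ := ih (decode t (decode M x)) (Nat.lor acc
        (Nat.lor (Nat.shiftLeft 1 x) (Nat.shiftLeft 1 (decode M x))))
      refine ⟨⟨y, hy, hy'.trans hP⟩, fun i hi => ?_⟩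
      rcases h2 i hi with h | h
      · exact hbit i h
      · exact Or.inr (h.trans hP)

/-- On one fibre with pairing `M`, the involution `t` extends `s₀` by cube edges on the vertices
fixed by `s₁`. -/
structure Compatible (s₀ s₁ t : Fin 8 → Fin 8) : Prop where
  fixed : ∀ x, s₁ x = x → s₁ (t x) = t x
  invol : ∀ x, s₁ x = x → t (t x) = x
  adj : ∀ x, s₁ x = x → s₀ x = x → CubeAdj x (t x)
  moved : ∀ x, s₁ x = x → s₀ x ≠ x → t x = s₀ x
  disjoint : ∀ x, s₁ x ≠ x → s₀ x = x
  invol_right : ∀ x, s₁ x ≠ x → s₁ (s₁ x) = x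

theorem compatible_sound {s₀ s₁ t : ℕ} (h : compatible s₀ s₁ t = true) :
    Compatible (decode s₀) (decode s₁) (decode t) := by
  have key : ∀ x : Fin 8,
      (decode s₁ x = x → decode s₁ (decode t x) = decode t x ∧ decode t (decode t x) = x ∧
        (decode s₀ x = x → CubeAdj x (decode t x)) ∧
        (decode s₀ x ≠ x → decode t x = decode s₀ x)) ∧
      (decode s₁ x ≠ x → decode s₀ x = x ∧ decode s₁ (decode s₁ x) = x) := by
    intro x
    have hx := (all8_iff _).1 h x
    have e1 : dig t x = decode t x := rfl
    have e2 : dig t (decode t x) = decode t (decode t x) := rfl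
    have e3 : dig s₀ x = decode s₀ x := rfl
    have e4 : dig s₁ x = decode s₁ x := rfl
    have e5 : dig s₁ (decode s₁ x) = decode s₁ (decode s₁ x) := rfl
    simp only [e1, e2, e3, e4, e5] at hx
    cases h1 : fixes s₁ x with
    | true =>
      have h1' := (fixes_iff _ _).1 h1
      simp only [h1, cond_true, Bool.and_eq_true, natBeq_iff, fixes_iff] at hx
      obtain ⟨ha, hb, hc⟩ := hx
      refine ⟨fun _ => ⟨ha, Fin.ext hb, fun h0 => ?_, fun h0 => ?_⟩, fun h => absurd h1' h⟩
      · rw [(fixes_iff _ _).2 h0] at hc; exact hc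
      · cases h0' : fixes s₀ x with
        | true => exact absurd ((fixes_iff _ _).1 h0') h0
        | false =>
          simp only [h0', cond_false, natBeq_iff] at hc
          exact Fin.ext hc
    | false =>
      have h1' : decode s₁ x ≠ x := fun h => by
        rw [(fixes_iff _ _).2 h] at h1; exact Bool.noConfusion h1
      simp only [h1, cond_false, Bool.and_eq_true, natBeq_iff, fixes_iff] at hx
      exact ⟨fun h => absurd h h1', fun _ => ⟨hx.1, Fin.ext hx.2⟩⟩
  exact ⟨fun x h => ((key x).1 h).1, fun x h => ((key x).1 h).2.1, fun x h => ((key x).1 h).2.2.1,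
    fun x h => ((key x).1 h).2.2.2, fun x h => ((key x).2 h).1, fun x h => ((key x).2 h).2⟩

/-- The two claims on `P` say that the paths of `M` and `t` realise the links of `s₁`, and that
every vertex lies on a path ending at a rung to the right. -/
theorem continues_sound {M s₀ s₁ : ℕ} (h : continues M s₀ s₁ = true) :
    ∃ t : Fin 8 → Fin 8, Compatible (decode s₀) (decode s₁) t ∧
      ∀ P : Fin 8 → Prop, (∀ x, P x ↔ P (decode M x)) →
        (∀ x, decode s₁ x = x → (P x ↔ P (t x))) →
        (∀ x, decode s₁ x ≠ x → (P x ↔ P (decode s₁ x))) ∧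
        ∀ x, ∃ u, decode s₁ u ≠ u ∧ (P x ↔ P u) := by
  simp only [continues, Bool.and_eq_true] at h
  obtain ⟨t, ht⟩ := anyMatching_sound h.2
  simp only [Bool.and_eq_true, linked] at ht
  obtain ⟨⟨hl, hc⟩, ht⟩ := ht
  refine ⟨decode t, compatible_sound ht, fun P hM hP => ⟨fun x hx => ?_, fun x => ?_⟩⟩
  · have := (all8_iff _).1 hl x
    simp only [Bool.or_eq_true, fixes_iff, natBeq_iff] at this
    have h1 := this.resolve_left hx
    obtain ⟨⟨y, hy, hy'⟩, -⟩ := trace_sound (s := s₁) hM hP 4 x 0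
    have e : decode s₁ x = y := Fin.ext (h1.symm.trans hy)
    rw [e, hy']
  · by_contra hcon
    push Not at hcon
    -- A bit in the union of the masks comes from the trace of some vertex moved by `s₁`, which
    -- `hcon` separates from `x`.
    have hbit : ∀ l : List ℕ, (∀ y ∈ l, y < 8) →
        ((l.foldr (fun x acc => Nat.lor acc
          (bif fixes s₁ x then 0 else (trace M t s₁ 4 x 0).2)) 0).testBit x = true) → False := by
      intro l hl
      induction l with
      | nil => simp
      | cons y l ih =>
        intro hb
        rw [List.foldr_cons, show ∀ a b : ℕ, Nat.lor a b = a ||| b from fun _ _ => rfl,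
          Nat.testBit_or, Bool.or_eq_true] at hb
        rcases hb with hb | hb
        · exact ih (fun z hz => hl z (List.mem_cons_of_mem _ hz)) hb
        · have hy8 := hl y List.mem_cons_self
          have hfix := fixes_iff s₁ ⟨y, hy8⟩
          simp only at hfix
          cases hf : fixes s₁ y with
          | true => rw [hf] at hb; simp at hb
          | false =>
            rw [hf, cond_false] at hb
            have hne : decode s₁ ⟨y, hy8⟩ ≠ ⟨y, hy8⟩ := fun h => by
              rw [hfix.2 h] at hf; exact Bool.noConfusion hf
            rcases (trace_sound (s := s₁) hM hP 4 ⟨y, hy8⟩ 0).2 x hb with h0 | h0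
            · simp at h0
            · rcases hcon _ hne with ⟨ha, hb⟩ | ⟨ha, hb⟩
              · exact hb (h0.1 ha)
              · exact ha (h0.2 hb)
    refine hbit octet (by decide +kernel) ?_
    rw [natBeq_iff] at hc
    rw [hc]
    exact testBit_mask x

theorem completes_sound {M s₀ : ℕ} (h : completes M s₀ = true) :
    ∃ t : Fin 8 → Fin 8, Compatible (decode s₀) id t ∧
      ∀ P : Fin 8 → Prop, (∀ x, P x ↔ P (decode M x)) → (∀ x, P x ↔ P (t x)) →
        ∀ x y, P x ↔ P y := by
  obtain ⟨t, ht⟩ := anyMatching_sound h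
  simp only [Bool.and_eq_true, natBeq_iff] at ht
  have hid : decode idCode = id := funext decode_idCode
  refine ⟨decode t, hid ▸ compatible_sound ht.2, fun P hM hP => ?_⟩
  have key : ∀ x, P x ↔ P 0 := fun x => by
    have := (trace_sound (s := idCode) hM (fun x _ => hP x) 4 0 0).2 x (by
      have h255 : (trace M t idCode 4 ((0 : Fin 8) : ℕ) 0).2 = 255 := ht.1
      rw [h255]; exact testBit_mask x)
    simpa using this
  exact fun x y => (key x).trans (key y).symm

/-- Here completeness of the enumeration matters, because the checks range over its members.
Removing the head and its partner leaves a list preserved by `f`. -/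
theorem mem_pairingCodes (f : ℕ → ℕ) (k : ℕ) (l : List ℕ) (hl : l.Nodup) (hk : l.length ≤ 2 * k)
    (hmem : ∀ x ∈ l, f x ∈ l) (hne : ∀ x ∈ l, f x ≠ x) (hinv : ∀ x ∈ l, f (f x) = x) :
    (l.map fun x => f x * 8 ^ x).sum ∈ pairingCodes k l := by
  induction k generalizing l with
  | zero =>
    have : l = [] := List.length_eq_zero_iff.1 (by omega)
    subst this; simp [pairingCodes]
  | succ k ih =>
    cases l with
    | nil => simp [pairingCodes]
    | cons a l =>
      have hal : a ∉ l := (List.nodup_cons.1 hl).1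
      have hl' : l.Nodup := (List.nodup_cons.1 hl).2
      have hb : f a ∈ l := (List.mem_cons.1 (hmem a List.mem_cons_self)).resolve_left
        (hne a List.mem_cons_self)
      have hfa := hinv a List.mem_cons_self
      simp only [pairingCodes, List.mem_flatMap, List.mem_map]
      refine ⟨f a, hb, _, ih (l.erase (f a)) (hl'.erase _) ?_ ?_ ?_ ?_, ?_⟩
      · rw [List.length_erase_of_mem hb]; simp at hk; omega
      · intro x hx
        rw [hl'.mem_erase_iff] at hx ⊢
        have hxl := List.mem_cons_of_mem a hx.2
        refine ⟨fun h => ?_, (List.mem_cons.1 (hmem x hxl)).resolve_left fun h => ?_⟩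
        · have := hinv x hxl
          rw [h, hfa] at this
          exact hal (this ▸ hx.2)
        · apply hx.1; rw [← h, hinv x hxl]
      · intro x hx; exact hne x (List.mem_cons_of_mem _ (List.mem_of_mem_erase hx))
      · intro x hx; exact hinv x (List.mem_cons_of_mem _ (List.mem_of_mem_erase hx))
      · rw [List.map_cons, List.sum_cons, ← List.sum_map_erase (fun x => f x * 8 ^ x) hb, hfa,
          add_assoc]

theorem octet_sum (f : ℕ → ℕ) : (octet.map f).sum = ∑ x : Fin 8, f x := by
  rw [Fin.sum_univ_eight]
  change f 0 + (f 1 + (f 2 + (f 3 + (f 4 + (f 5 + (f 6 + (f 7 + 0))))))) =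
    f 0 + f 1 + f 2 + f 3 + f 4 + f 5 + f 6 + f 7
  ring

theorem decode_sum (f : ℕ → ℕ) (m : Fin 8 → Fin 8) (hf : ∀ x : Fin 8, f x = m x) :
    decode (octet.map fun x => f x * 8 ^ x).sum = m := by
  funext z
  have h := dig_sum (fun x => (m x : ℕ)) (fun x => (m x).isLt) z
  rw [octet_sum]
  simp only [hf]
  exact Fin.ext h

theorem exists_letter (m : Fin 8 → Fin 8) (hne : ∀ x, m x ≠ x) (hinv : ∀ x, m (m x) = x) :
    ∃ c ∈ letters, decode c = m := by
  -- The value 0 outside the cube is never used.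
  let f : ℕ → ℕ := fun x => if h : x < 8 then m ⟨x, h⟩ else 0
  have hf : ∀ x : Fin 8, f x = m x := fun x => by simp [f]
  have hoct : ∀ x ∈ octet, ∃ y : Fin 8, x = y := fun x hx =>
    ⟨⟨x, (by decide +kernel : ∀ x ∈ octet, x < 8) x hx⟩, rfl⟩
  have hoct' : ∀ x : Fin 8, (x : ℕ) ∈ octet := by decide +kernel
  refine ⟨_, mem_pairingCodes f 4 octet (by decide +kernel) (by decide +kernel) ?_ ?_ ?_,
    decode_sum f m hf⟩
  · intro x hx
    obtain ⟨x, rfl⟩ := hoct x hx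
    rw [hf]
    exact hoct' _
  · intro x hx h
    obtain ⟨x, rfl⟩ := hoct x hx
    rw [hf] at h
    exact hne x (Fin.ext h)
  · intro x hx
    obtain ⟨x, rfl⟩ := hoct x hx
    rw [hf, hf, hinv]

theorem automorphism_sound {g : ℕ} (h : isAutomorphism g = true) :
    Function.Bijective (decode g) ∧ ∀ x y, CubeAdj (decode g x) (decode g y) ↔ CubeAdj x y := by
  have key : ∀ x y : Fin 8, (decode g x = decode g y → x = y) ∧
      (CubeAdj (decode g x) (decode g y) ↔ CubeAdj x y) := by
    intro x y
    have := (all8_iff _).1 ((all8_iff _).1 h x) y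
    simp only [Bool.and_eq_true, beq_iff_eq] at this
    refine ⟨fun hxy => ?_, ?_⟩
    · have e : Nat.beq (dig g x) (dig g y) = true := by
        rw [natBeq_iff]; exact congrArg Fin.val hxy
      rw [e] at this
      exact Fin.ext (by simpa using this.1.symm)
    · exact iff_of_eq (congrArg (· = true) this.2)
  exact ⟨Finite.injective_iff_bijective.1 fun x y => (key x y).1, fun x y => (key x y).2⟩

theorem decode_conjCode {g s : ℕ} (hg : Function.Bijective (decode g)) (x : Fin 8) :
    decode (conjCode g s) (decode g x) = decode g (decode s x) := by
  let e := Equiv.ofBijective _ hg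
  -- Reindexing by `g` turns the sum into an octal expansion indexed by position.
  have h : conjCode g s =
      ∑ y : Fin 8, ((decode g (decode s (e.symm y)) : Fin 8) : ℕ) * 8 ^ (y : ℕ) := by
    rw [conjCode, sum8_eq, ← e.sum_comp fun y =>
      ((decode g (decode s (e.symm y)) : Fin 8) : ℕ) * 8 ^ (y : ℕ)]
    refine Finset.sum_congr rfl fun y _ => ?_
    rw [put_eq, Equiv.symm_apply_apply]
    rfl
  apply Fin.ext
  change dig _ _ = _
  rw [h, dig_sum _ fun y => Fin.isLt _]
  have : e.symm (decode g x) = x := e.symm_apply_apply x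
  rw [this]

/-! ### Pairings of finite sets -/

section Pairings

variable {α : Type*}

/-- `m` restricts to an involution without fixed points of `S`. -/
structure IsPairing (S : Finset α) (m : α → α) : Prop where
  map : ∀ v ∈ S, m v ∈ S
  ne : ∀ v ∈ S, m v ≠ v
  invol : ∀ v ∈ S, m (m v) = v

/-- The graph on `S` with edges `v — m v` and `v — n v` is connected. -/
def Spans (S : Finset α) (m n : α → α) : Prop :=
  ∀ P : α → Prop, (∀ v ∈ S, P v ↔ P (m v)) → (∀ v ∈ S, P v ↔ P (n v)) →
    ∀ u ∈ S, ∀ v ∈ S, P u ↔ P v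

/-- Every pairing of `S` is completed to a connected graph by some perfect matching of `adj`. -/
def Extendable (adj : α → α → Prop) (S : Finset α) : Prop :=
  ∀ m, IsPairing S m → ∃ n, IsPairing S n ∧ (∀ v ∈ S, adj v (n v)) ∧ Spans S m n

/-- The two members of each pair cancel in a sum of ones over `ZMod 2`. -/
theorem IsPairing.even_card {S : Finset α} {m : α → α} (h : IsPairing S m) : Even S.card := by
  have := Finset.sum_involution (s := S) (f := fun _ => (1 : ZMod 2)) (fun v _ => m v)
    (fun _ _ => by decide) (fun v hv _ => h.ne v hv) (fun v hv => h.map v hv)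
    (fun v hv => h.invol v hv)
  rw [Finset.sum_const, nsmul_eq_mul, mul_one] at this
  exact (ZMod.natCast_eq_zero_iff_even).1 this

variable [DecidableEq α]

/-- A set all of whose classes under an equivalence relation are even can be paired inside the
classes. -/
theorem exists_pairing_of_even (r : α → α → Prop) (hr : Equivalence r) [DecidableRel r]
    (S : Finset α) (h : ∀ v ∈ S, Even (S.filter (r v)).card) :
    ∃ p, IsPairing S p ∧ ∀ v ∈ S, r v (p v) := by
  induction hS : S.card using Nat.strong_induction_on generalizing S with
  | _ k ih =>
    rcases S.eq_empty_or_nonempty with rfl | ⟨b, hb⟩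
    · exact ⟨id, ⟨by simp, by simp, by simp⟩, by simp⟩
    have hbmem : b ∈ S.filter (r b) := Finset.mem_filter.2 ⟨hb, hr.refl b⟩
    -- The class of `b` is even and contains `b`, so it has a second element.
    obtain ⟨c, hc, hcb⟩ : ∃ c ∈ S.filter (r b), c ≠ b := by
      by_contra hcon
      push Not at hcon
      have : S.filter (r b) = {b} :=
        Finset.eq_singleton_iff_unique_mem.2 ⟨hbmem, hcon⟩
      have h1 := h b hb
      rw [this] at h1
      simp at h1
    rw [Finset.mem_filter] at hc
    obtain ⟨hcS, hrc⟩ := hc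
    set T := (S.erase b).erase c with hT
    have hcT : c ∈ S.erase b := Finset.mem_erase.2 ⟨hcb, hcS⟩
    have hmemT : ∀ v, v ∈ T ↔ v ≠ c ∧ v ≠ b ∧ v ∈ S := fun v => by
      simp [hT]
    have hTcard : T.card < k := by
      rw [← hS]
      exact Finset.card_lt_card ((Finset.erase_subset _ _).trans_ssubset (Finset.erase_ssubset hb))
    -- Being equivalent, `b` and `c` are removed from the same class.
    have hTeven : ∀ v ∈ T, Even (T.filter (r v)).card := by
      intro v hv
      have hvS := ((hmemT v).1 hv).2.2
      by_cases hvb : r v b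
      · have e : T.filter (r v) = ((S.filter (r v)).erase b).erase c := by
          ext x; simp only [hT, Finset.mem_filter, Finset.mem_erase]; tauto
        have hb' : b ∈ S.filter (r v) := Finset.mem_filter.2 ⟨hb, hvb⟩
        have hc' : c ∈ (S.filter (r v)).erase b :=
          Finset.mem_erase.2 ⟨hcb, Finset.mem_filter.2 ⟨hcS, hr.trans hvb hrc⟩⟩
        rw [e, Finset.card_erase_of_mem hc', Finset.card_erase_of_mem hb']
        have h1 := h v hvS
        obtain ⟨j, hj⟩ := h1
        exact ⟨j - 1, by omega⟩
      · have e : T.filter (r v) = S.filter (r v) := by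
          ext x
          simp only [Finset.mem_filter, hmemT]
          refine ⟨fun hx => ⟨hx.1.2.2, hx.2⟩, fun hx => ⟨⟨?_, ?_, hx.1⟩, hx.2⟩⟩
          · rintro rfl; exact hvb (hr.trans hx.2 (hr.symm hrc))
          · rintro rfl; exact hvb hx.2
        rw [e]; exact h v hvS
    obtain ⟨p, hp, hpr⟩ := ih _ hTcard T hTeven rfl
    have hbT : b ∉ T := fun h => ((hmemT b).1 h).2.1 rfl
    have hcT' : c ∉ T := fun h => ((hmemT c).1 h).1 rfl
    let q : α → α := fun v => if v = b then c else if v = c then b else p v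
    have qb : q b = c := by simp [q]
    have qc : q c = b := by simp [q, hcb]
    have qT : ∀ v ∈ T, q v = p v := fun v hv => by
      have := (hmemT v).1 hv
      simp [q, this.1, this.2.1]
    have hcases : ∀ v ∈ S, v = b ∨ v = c ∨ v ∈ T := fun v hv => by
      rw [hmemT]; tauto
    refine ⟨q, ⟨fun v hv => ?_, fun v hv => ?_, fun v hv => ?_⟩, fun v hv => ?_⟩
    · rcases hcases v hv with rfl | rfl | hv
      · rwa [qb]
      · rwa [qc]
      · rw [qT v hv]; exact ((hmemT _).1 (hp.map v hv)).2.2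
    · rcases hcases v hv with rfl | rfl | hv
      · rwa [qb]
      · rw [qc]; exact hcb.symm
      · rw [qT v hv]; exact hp.ne v hv
    · rcases hcases v hv with rfl | rfl | hv
      · rw [qb, qc]
      · rw [qc, qb]
      · rw [qT v hv, qT _ (hp.map v hv), hp.invol v hv]
    · rcases hcases v hv with rfl | rfl | hv
      · rwa [qb]
      · rw [qc]; exact hr.symm hrc
      · rw [qT v hv]; exact hpr v hv

/-- A pairing crossing between two disjoint extendable sets extends on their union. -/
theorem extends_of_crossing {adj : α → α → Prop} {A B : Finset α} (hAB : Disjoint A B)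
    (hA : Extendable adj A) (hB : Extendable adj B) (hAe : Even A.card) {m : α → α}
    (hm : IsPairing (A ∪ B) m) (hcross : ∃ a ∈ A, m a ∈ B) :
    ∃ n, IsPairing (A ∪ B) n ∧ (∀ v ∈ A ∪ B, adj v (n v)) ∧ Spans (A ∪ B) m n := by
  classical
  have hAU : ∀ {v}, v ∈ A → v ∈ A ∪ B := fun h => Finset.mem_union_left _ h
  have hBU : ∀ {v}, v ∈ B → v ∈ A ∪ B := fun h => Finset.mem_union_right _ h
  have hdis : ∀ {v}, v ∈ A → v ∉ B := fun h h' => Finset.disjoint_left.1 hAB h h'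
  let X := A.filter fun a => m a ∈ B
  let Y := A.filter fun a => m a ∈ A
  have hY : IsPairing Y m := by
    refine ⟨fun v hv => ?_, fun v hv => ?_, fun v hv => ?_⟩ <;>
      rw [Finset.mem_filter] at hv
    · exact Finset.mem_filter.2 ⟨hv.2, by rw [hm.invol v (hAU hv.1)]; exact hv.1⟩
    · exact hm.ne v (hAU hv.1)
    · exact hm.invol v (hAU hv.1)
  have hXY : Y = A \ X := by
    ext v
    simp only [X, Y, Finset.mem_filter, Finset.mem_sdiff]
    refine ⟨fun h => ⟨h.1, fun h' => hdis h.2 h'.2⟩, fun h => ⟨h.1, ?_⟩⟩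
    rcases Finset.mem_union.1 (hm.map v (hAU h.1)) with h' | h'
    · exact h'
    · exact absurd ⟨h.1, h'⟩ h.2
  have hXA : X ⊆ A := Finset.filter_subset _ _
  have hXe : Even X.card := by
    have h1 := hY.even_card
    rw [hXY, Finset.card_sdiff_of_subset hXA] at h1
    have h2 := Finset.card_le_card hXA
    obtain ⟨i, hi⟩ := h1
    obtain ⟨j, hj⟩ := hAe
    exact ⟨j - i, by omega⟩
  -- The fictitious pairs of `p` stand in for the pairs of `m` that leave `A`; any pairing of `X`
  -- will do.
  obtain ⟨p, hp, -⟩ := exists_pairing_of_even (fun _ _ : α => True)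
    ⟨fun _ => trivial, fun _ => trivial, fun _ _ => trivial⟩ X (fun v _ => by simpa using hXe)
  let mA : α → α := fun v => if v ∈ X then p v else m v
  have hAY : ∀ v ∈ A, v ∉ X → v ∈ Y := fun v hv hx => by
    rw [hXY]; exact Finset.mem_sdiff.2 ⟨hv, hx⟩
  have hYX : ∀ v ∈ Y, v ∉ X := fun v hv => by
    rw [hXY] at hv; exact (Finset.mem_sdiff.1 hv).2
  have hYA : ∀ v ∈ Y, v ∈ A := fun v hv => (Finset.mem_filter.1 hv).1
  have mX : ∀ v ∈ X, mA v = p v := fun v hv => by simp [mA, hv]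
  have mY : ∀ v ∈ Y, mA v = m v := fun v hv => by simp [mA, hYX v hv]
  have hmA : IsPairing A mA := by
    refine ⟨fun v hv => ?_, fun v hv => ?_, fun v hv => ?_⟩ <;> by_cases hx : v ∈ X
    · rw [mX v hx]; exact hXA (hp.map v hx)
    · have := hAY v hv hx
      rw [mY v this]; exact hYA _ (hY.map v this)
    · rw [mX v hx]; exact hp.ne v hx
    · have := hAY v hv hx
      rw [mY v this]; exact hY.ne v this
    · rw [mX v hx, mX _ (hp.map v hx), hp.invol v hx]
    · have := hAY v hv hx
      rw [mY v this, mY _ (hY.map v this), hY.invol v this]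
  obtain ⟨nA, hnA, hadjA, hspA⟩ := hA mA hmA
  -- Lying in the same component of the graph formed by `m` on the union and `nA` on `A`.
  let r : α → α → Prop := fun u v => ∀ P : α → Prop, (∀ v ∈ A ∪ B, P v ↔ P (m v)) →
    (∀ v ∈ A, P v ↔ P (nA v)) → (P u ↔ P v)
  have hr : Equivalence r :=
    ⟨fun _ _ _ _ => Iff.rfl, fun h P h1 h2 => (h P h1 h2).symm,
      fun h h' P h1 h2 => (h P h1 h2).trans (h' P h1 h2)⟩
  have hrm : ∀ v ∈ A ∪ B, r v (m v) := fun v hv P h1 _ => h1 v hv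
  have hrn : ∀ v ∈ A, r v (nA v) := fun v hv P _ h2 => h2 v hv
  -- A component is paired by `m` and its part in `A` by `nA`, so its part in `B` is even.
  have heven : ∀ v ∈ B, Even (B.filter (r v)).card := by
    intro v _
    have h1 : IsPairing ((A ∪ B).filter (r v)) m := by
      refine ⟨fun w hw => ?_, fun w hw => ?_, fun w hw => ?_⟩ <;> rw [Finset.mem_filter] at hw
      · exact Finset.mem_filter.2 ⟨hm.map w hw.1, hr.trans hw.2 (hrm w hw.1)⟩
      · exact hm.ne w hw.1
      · exact hm.invol w hw.1
    have h2 : IsPairing (A.filter (r v)) nA := by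
      refine ⟨fun w hw => ?_, fun w hw => ?_, fun w hw => ?_⟩ <;> rw [Finset.mem_filter] at hw
      · exact Finset.mem_filter.2 ⟨hnA.map w hw.1, hr.trans hw.2 (hrn w hw.1)⟩
      · exact hnA.ne w hw.1
      · exact hnA.invol w hw.1
    have h3 : ((A ∪ B).filter (r v)).card = (A.filter (r v)).card + (B.filter (r v)).card := by
      rw [Finset.filter_union]
      exact Finset.card_union_of_disjoint (Finset.disjoint_filter_filter hAB)
    have e1 := h1.even_card
    rw [h3] at e1
    exact (Nat.even_add.1 e1).1 h2.even_card
  obtain ⟨mB, hmB, hrB⟩ := exists_pairing_of_even r hr B heven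
  obtain ⟨nB, hnB, hadjB, hspB⟩ := hB mB hmB
  let n : α → α := fun v => if v ∈ A then nA v else nB v
  have nEA : ∀ v ∈ A, n v = nA v := fun v hv => by simp [n, hv]
  have nEB : ∀ v ∈ B, n v = nB v := fun v hv => by
    have : v ∉ A := fun h => hdis h hv
    simp [n, this]
  refine ⟨n, ⟨fun v hv => ?_, fun v hv => ?_, fun v hv => ?_⟩, fun v hv => ?_, ?_⟩
  · rcases Finset.mem_union.1 hv with h | h
    · rw [nEA v h]; exact hAU (hnA.map v h)
    · rw [nEB v h]; exact hBU (hnB.map v h)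
  · rcases Finset.mem_union.1 hv with h | h
    · rw [nEA v h]; exact hnA.ne v h
    · rw [nEB v h]; exact hnB.ne v h
  · rcases Finset.mem_union.1 hv with h | h
    · rw [nEA v h, nEA _ (hnA.map v h), hnA.invol v h]
    · rw [nEB v h, nEB _ (hnB.map v h), hnB.invol v h]
  · rcases Finset.mem_union.1 hv with h | h
    · rw [nEA v h]; exact hadjA v h
    · rw [nEB v h]; exact hadjB v h
  · intro P hPm hPn
    have hPA : ∀ v ∈ A, P v ↔ P (nA v) := fun v hv => by rw [← nEA v hv]; exact hPn v (hAU hv)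
    have hPB : ∀ v ∈ B, P v ↔ P (nB v) := fun v hv => by rw [← nEB v hv]; exact hPn v (hBU hv)
    have hBconst := hspB P (fun v hv => hrB v hv P hPm hPA) hPB
    obtain ⟨a₀, ha₀, hma₀⟩ := hcross
    have ha₀X : a₀ ∈ X := Finset.mem_filter.2 ⟨ha₀, hma₀⟩
    have key : ∀ a ∈ A, P a ↔ P (m a₀) := by
      intro a ha
      by_contra hcon
      -- If `a` were separated from `B`, then `Q` would fail throughout `X`. It would then be
      -- constant along `mA` and `nA`, and so would hold at `a₀ ∈ X`.
      let Q : α → Prop := fun v => (P v ↔ P a)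
      have hQX : ∀ v ∈ X, ¬ Q v := fun v hv hq => by
        rw [Finset.mem_filter] at hv
        exact hcon ((hq.symm.trans (hPm v (hAU hv.1))).trans (hBconst _ hv.2 _ hma₀))
      have := hspA Q (fun v hv => ?_) (fun v hv => iff_congr (hPA v hv) Iff.rfl) a ha a₀ ha₀
      · exact hQX a₀ ha₀X (this.1 Iff.rfl)
      · by_cases hx : v ∈ X
        · rw [mX v hx]
          exact iff_of_false (hQX v hx) (hQX _ (hp.map v hx))
        · rw [mY v (hAY v hv hx)]
          exact iff_congr (hPm v (hAU hv)) Iff.rfl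
    have all : ∀ v ∈ A ∪ B, P v ↔ P (m a₀) := fun v hv => by
      rcases Finset.mem_union.1 hv with h | h
      · exact key v h
      · exact hBconst v h _ hma₀
    exact fun u hu v hv => (all u hu).trans (all v hv).symm

end Pairings

/-! ### The product of a path with the three-dimensional cube -/

/-- Adjacency in the product of the infinite path on `ℕ` with the cube. -/
def PathCubeAdj (v w : ℕ × Fin 8) : Prop :=
  (v.1 = w.1 ∧ CubeAdj v.2 w.2) ∨ (v.2 = w.2 ∧ (v.1 + 1 = w.1 ∨ w.1 + 1 = v.1))

theorem PathCubeAdj.ne {v w : ℕ × Fin 8} (h : PathCubeAdj v w) : w ≠ v := by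
  rintro rfl
  rcases h with h | h
  · exact h.2.ne rfl
  · omega

/-- The fibres `a, …, b - 1`. -/
def slab (a b : ℕ) : Finset (ℕ × Fin 8) := Finset.Ico a b ×ˢ Finset.univ

theorem mem_slab {a b : ℕ} {v : ℕ × Fin 8} : v ∈ slab a b ↔ a ≤ v.1 ∧ v.1 < b := by
  simp [slab]

/-- The pairing of a slab given by a self-map of every fibre. -/
def fibrewise (μ : ℕ → Fin 8 → Fin 8) (v : ℕ × Fin 8) : ℕ × Fin 8 := (v.1, μ v.1 v.2)

/-- `n` completes the state `s` on the left of fibre `a`: the vertices of fibre `a` moved by `s`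
are joined by `s` and the others are perfectly matched, so that together with the
pairing `μ` everything becomes connected. -/
structure Completion (μ : ℕ → Fin 8 → Fin 8) (a b : ℕ) (s : Fin 8 → Fin 8)
    (n : ℕ × Fin 8 → ℕ × Fin 8) : Prop where
  map : ∀ v ∈ slab a b, n v ∈ slab a b
  invol : ∀ v ∈ slab a b, n (n v) = v
  moved : ∀ x, s x ≠ x → n (a, x) = (a, s x)
  adj : ∀ v ∈ slab a b, (v.1 = a → s v.2 = v.2) → PathCubeAdj v (n v)
  spans : Spans (slab a b) (fibrewise μ) n

/-- The state `s` on the left of fibre `a` can be completed. -/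
def Completable (μ : ℕ → Fin 8 → Fin 8) (a b : ℕ) (s : Fin 8 → Fin 8) : Prop :=
  ∃ n, Completion μ a b s n

theorem completable_last {μ : ℕ → Fin 8 → Fin 8} {a M s₀ : ℕ} (hM : decode M = μ a)
    (h : completes M s₀ = true) : Completable μ a (a + 1) (decode s₀) := by
  obtain ⟨t, ht, hP⟩ := completes_sound h
  have hfst : ∀ {v}, v ∈ slab a (a + 1) → v.1 = a := fun hv => by
    have := mem_slab.1 hv; omega
  refine ⟨fun v => (v.1, t v.2), fun v hv => mem_slab.2 (mem_slab (v := v).1 hv),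
    fun v hv => ?_,
    fun x hx => ?_, fun v hv hs => ?_, fun P h1 h2 => ?_⟩
  · simp [ht.invol v.2 rfl]
  · simp [ht.moved x rfl hx]
  · exact Or.inl ⟨rfl, ht.adj v.2 rfl (hs (hfst hv))⟩
  · have hmem : ∀ x, (a, x) ∈ slab a (a + 1) := fun x => mem_slab.2 ⟨le_rfl, Nat.lt_succ_self a⟩
    have key := hP (fun x => P (a, x)) (fun x => by rw [hM]; exact h1 _ (hmem x))
      (fun x => h2 _ (hmem x))
    intro u hu v hv
    have eu : u = (a, u.2) := Prod.ext (hfst hu) rfl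
    have ev : v = (a, v.2) := Prod.ext (hfst hv) rfl
    rw [eu, ev]
    exact key _ _

/-- The virtual edges of `s₁` in a completion on the right are replaced by two rungs and a path of
`M` and `t` inside fibre `a`. -/
theorem completable_step {μ : ℕ → Fin 8 → Fin 8} {a b M s₀ s₁ : ℕ} (hab : a + 1 < b)
    (hM : decode M = μ a) (h : continues M s₀ s₁ = true)
    (hc : Completable μ (a + 1) b (decode s₁)) : Completable μ a b (decode s₀) := by
  obtain ⟨t, ht, hP⟩ := continues_sound h
  obtain ⟨n₁, hn⟩ := hc
  set σ₀ := decode s₀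
  set σ₁ := decode s₁
  let n : ℕ × Fin 8 → ℕ × Fin 8 := fun v =>
    if v.1 = a then (if σ₁ v.2 = v.2 then (a, t v.2) else (a + 1, v.2))
    else if v.1 = a + 1 ∧ σ₁ v.2 ≠ v.2 then (a, v.2) else n₁ v
  have hne : a + 1 ≠ a := Nat.succ_ne_self a
  have n1 : ∀ x, σ₁ x = x → n (a, x) = (a, t x) := fun x hx => by simp [n, hx]
  have n2 : ∀ x, σ₁ x ≠ x → n (a, x) = (a + 1, x) := fun x hx => by simp [n, hx]
  have n3 : ∀ x, σ₁ x ≠ x → n (a + 1, x) = (a, x) := fun x hx => by simp [n, hx]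
  have n4 : ∀ v ∈ slab (a + 1) b, (v.1 = a + 1 → σ₁ v.2 = v.2) → n v = n₁ v := fun v hv hx => by
    have h1 : v.1 ≠ a := by have := mem_slab.1 hv; omega
    have h2 : ¬ (v.1 = a + 1 ∧ σ₁ v.2 ≠ v.2) := fun h => h.2 (hx h.1)
    simp only [n, if_neg h1, if_neg h2]
  have hsub : ∀ {v}, v ∈ slab (a + 1) b → v ∈ slab a b := fun hv => by
    rw [mem_slab] at hv ⊢; omega
  have hmema : ∀ x, (a, x) ∈ slab a b := fun x => by rw [mem_slab]; dsimp only; omega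
  have hmemb : ∀ x, (a + 1, x) ∈ slab (a + 1) b := fun x => by rw [mem_slab]; dsimp only; omega
  have hsplit : ∀ v ∈ slab a b, (∃ x, σ₁ x = x ∧ v = (a, x)) ∨ (∃ x, σ₁ x ≠ x ∧ v = (a, x)) ∨
      (∃ x, σ₁ x ≠ x ∧ v = (a + 1, x)) ∨
      (v ∈ slab (a + 1) b ∧ (v.1 = a + 1 → σ₁ v.2 = v.2)) := by
    intro v hv
    by_cases h1 : v.1 = a
    · by_cases h2 : σ₁ v.2 = v.2
      · exact Or.inl ⟨v.2, h2, Prod.ext h1 rfl⟩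
      · exact Or.inr (Or.inl ⟨v.2, h2, Prod.ext h1 rfl⟩)
    · by_cases h2 : v.1 = a + 1 ∧ σ₁ v.2 ≠ v.2
      · exact Or.inr (Or.inr (Or.inl ⟨v.2, h2.2, Prod.ext h2.1 rfl⟩))
      · refine Or.inr (Or.inr (Or.inr ⟨?_, fun h => not_not.1 fun h' => h2 ⟨h, h'⟩⟩))
        rw [mem_slab] at hv ⊢; omega
  -- `n₁` preserves the set of vertices not moved by `σ₁`
  have hstay : ∀ v ∈ slab (a + 1) b, (v.1 = a + 1 → σ₁ v.2 = v.2) →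
      ((n₁ v).1 = a + 1 → σ₁ (n₁ v).2 = (n₁ v).2) := by
    intro v hv hx h1
    by_contra h2
    have h3 := hn.moved _ h2
    rw [show ((a + 1, (n₁ v).2) : ℕ × Fin 8) = n₁ v from Prod.ext h1.symm rfl, hn.invol v hv] at h3
    have h4 := hx (by rw [h3])
    rw [h3] at h4
    simp only at h4
    exact h2 ((ht.invol_right _ h2).symm.trans h4).symm
  refine ⟨n, fun v hv => ?_, fun v hv => ?_, fun x hx => ?_, fun v hv hs => ?_,
    fun P hPm hPn => ?_⟩
  · rcases hsplit v hv with ⟨x, hx, rfl⟩ | ⟨x, hx, rfl⟩ | ⟨x, hx, rfl⟩ | ⟨hv', hx⟩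
    · rw [n1 x hx]; exact hmema _
    · rw [n2 x hx]; exact hsub (hmemb _)
    · rw [n3 x hx]; exact hmema _
    · rw [n4 v hv' hx]; exact hsub (hn.map v hv')
  · rcases hsplit v hv with ⟨x, hx, rfl⟩ | ⟨x, hx, rfl⟩ | ⟨x, hx, rfl⟩ | ⟨hv', hx⟩
    · rw [n1 x hx, n1 _ (ht.fixed x hx), ht.invol x hx]
    · rw [n2 x hx, n3 x hx]
    · rw [n3 x hx, n2 x hx]
    · rw [n4 v hv' hx, n4 _ (hn.map v hv') (hstay v hv' hx), hn.invol v hv']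
  · have h1 : σ₁ x = x := not_not.1 fun h => hx (ht.disjoint x h)
    rw [n1 x h1, ht.moved x h1 hx]
  · rcases hsplit v hv with ⟨x, hx, rfl⟩ | ⟨x, hx, rfl⟩ | ⟨x, hx, rfl⟩ | ⟨hv', hx⟩
    · rw [n1 x hx]; exact Or.inl ⟨rfl, ht.adj x hx (hs rfl)⟩
    · rw [n2 x hx]; exact Or.inr ⟨rfl, Or.inl rfl⟩
    · rw [n3 x hx]; exact Or.inr ⟨rfl, Or.inr rfl⟩
    · rw [n4 v hv' hx]; exact hn.adj v hv' hx
  · obtain ⟨hlink, hcov⟩ := hP (fun x => P (a, x)) (fun x => by rw [hM]; exact hPm _ (hmema x))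
      (fun x hx => by rw [← n1 x hx]; exact hPn _ (hmema x))
    have hrung : ∀ x, σ₁ x ≠ x → (P (a, x) ↔ P (a + 1, x)) := fun x hx => by
      rw [← n2 x hx]; exact hPn _ (hmema x)
    -- Along a virtual edge of `σ₁`, `P` is transported through one rung, the path in fibre `a`, and
    -- the other rung.
    have hright := hn.spans P (fun v hv => hPm v (hsub hv)) fun v hv => by
      by_cases hx : v.1 = a + 1 → σ₁ v.2 = v.2
      · rw [← n4 v hv hx]; exact hPn v (hsub hv)
      · push Not at hx
        have hv' : v = (a + 1, v.2) := Prod.ext hx.1 rfl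
        have hmv : σ₁ (σ₁ v.2) ≠ σ₁ v.2 := by rw [ht.invol_right _ hx.2]; exact hx.2.symm
        rw [hv', hn.moved _ hx.2, ← hrung _ hx.2, ← hrung _ hmv]
        exact hlink _ hx.2
    have all : ∀ v ∈ slab a b, P v ↔ P (a + 1, 0) := fun v hv => by
      by_cases h1 : v.1 = a
      · obtain ⟨u, hu, hu'⟩ := hcov v.2
        rw [show v = (a, v.2) from Prod.ext h1 rfl, hu', hrung u hu]
        exact hright _ (hmemb u) _ (hmemb 0)
      · refine hright v ?_ _ (hmemb 0)
        rw [mem_slab] at hv ⊢; omega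
    exact fun u hu v hv => (all u hu).trans (all v hv).symm

/-- Completability is invariant under automorphisms of the cube. -/
theorem Completable.conj {μ : ℕ → Fin 8 → Fin 8} {a b : ℕ} {s s' : Fin 8 → Fin 8}
    (σ : Equiv.Perm (Fin 8)) (hσ : ∀ x y, CubeAdj (σ x) (σ y) ↔ CubeAdj x y)
    (hs : ∀ x, s (σ x) = σ (s' x)) (h : Completable μ a b s) :
    Completable (fun i x => σ.symm (μ i (σ x))) a b s' := by
  obtain ⟨n, hn⟩ := h
  have hmem : ∀ {v : ℕ × Fin 8} (x), v ∈ slab a b → (v.1, x) ∈ slab a b := fun x hv =>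
    mem_slab.2 (mem_slab (v := _).1 hv :)
  refine ⟨fun v => ((n (v.1, σ v.2)).1, σ.symm (n (v.1, σ v.2)).2), fun v hv => ?_, fun v hv => ?_,
    fun x hx => ?_, fun v hv hs' => ?_, fun P h1 h2 => ?_⟩
  · exact hmem (v := n (v.1, σ v.2)) _ (hn.map _ (hmem _ hv))
  · simp [hn.invol _ (hmem (σ v.2) hv)]
  · have hx' : s (σ x) ≠ σ x := by rw [hs]; exact fun h => hx (σ.injective h)
    simp [hn.moved _ hx', hs]
  · have h := hn.adj (v.1, σ v.2) (hmem _ hv) fun h => by simp [hs, hs' h]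
    rcases h with h | h
    · refine Or.inl ⟨h.1, ?_⟩
      rw [← hσ]
      simpa using h.2
    · refine Or.inr ⟨?_, h.2⟩
      simp [← h.1]
  · have key := hn.spans (fun v => P (v.1, σ.symm v.2)) (fun v hv => ?_) (fun v hv => ?_)
    · intro u hu v hv
      simpa using key (u.1, σ u.2) (hmem _ hu) (v.1, σ v.2) (hmem _ hv)
    · simpa [fibrewise] using h1 (v.1, σ.symm v.2) (hmem _ hv)
    · simpa using h2 (v.1, σ.symm v.2) (hmem _ hv)

/-! ### Transfer of the families along the path, from right to left -/

theorem someImage_sound {p : ℕ → Bool} (h : someImage p = true) :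
    ∃ A ∈ families, ∃ σ : Equiv.Perm (Fin 8), (∀ x y, CubeAdj (σ x) (σ y) ↔ CubeAdj x y) ∧
      ∀ s ∈ A, ∃ s', p s' = true ∧ ∀ x, decode s' (σ x) = σ (decode s x) := by
  simp only [someImage, List.any_eq_true, List.all_eq_true, force_eq] at h
  obtain ⟨⟨g, j⟩, hg, h⟩ := h
  obtain ⟨hbij, hadj⟩ := automorphism_sound (List.all_eq_true.1 images_automorphism _ hg)
  -- All indices are in range, so the default of `getD` is never taken.
  have hj : j < families.length :=
    (by decide +kernel : ∀ gj ∈ images, gj.2 < families.length) _ hg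
  refine ⟨families.getD j [], ?_, Equiv.ofBijective _ hbij, hadj, fun s hs =>
    ⟨_, h s hs, fun x => decode_conjCode hbij x⟩⟩
  rw [List.getD_eq_getElem _ _ hj]
  exact List.getElem_mem hj

/-- A pairing of every fibre. -/
def IsFibrePairing (μ : ℕ → Fin 8 → Fin 8) : Prop := ∀ i x, μ i x ≠ x ∧ μ i (μ i x) = x

theorem IsFibrePairing.conj {μ : ℕ → Fin 8 → Fin 8} (h : IsFibrePairing μ)
    (σ : Equiv.Perm (Fin 8)) : IsFibrePairing fun i x => σ.symm (μ i (σ x)) := fun i x =>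
  ⟨fun hx => (h i (σ x)).1 (σ.symm_apply_eq.1 hx), by simp [(h i (σ x)).2]⟩

theorem IsFibrePairing.exists_letter {μ : ℕ → Fin 8 → Fin 8} (h : IsFibrePairing μ) (i : ℕ) :
    ∃ M ∈ letters, decode M = μ i :=
  PrismPH.exists_letter (μ i) (fun x => (h i x).1) fun x => (h i x).2

/-- All states of some family, up to an automorphism, can be completed. -/
theorem exists_family_completable {μ : ℕ → Fin 8 → Fin 8} (hμ : IsFibrePairing μ) (k a : ℕ) :
    ∃ A ∈ families, ∃ σ : Equiv.Perm (Fin 8), (∀ x y, CubeAdj (σ x) (σ y) ↔ CubeAdj x y) ∧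
      ∀ s ∈ A, Completable (fun i x => σ.symm (μ i (σ x))) a (a + 1 + k) (decode s) := by
  induction k generalizing a with
  | zero =>
    obtain ⟨M, hM, hMμ⟩ := hμ.exists_letter a
    obtain ⟨A, hA, σ, hσ, h⟩ := someImage_sound (List.all_eq_true.1 letters_last M hM)
    refine ⟨A, hA, σ, hσ, fun s hs => ?_⟩
    obtain ⟨s', hs', hconj⟩ := h s hs
    exact (completable_last hMμ hs').conj σ hσ hconj
  | succ k ih =>
    obtain ⟨A₁, hA₁, σ₁, hσ₁, h₁⟩ := ih (a + 1)
    -- The family on the right is available only in the coordinates given by `σ₁`, so this fibre is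
    -- read in them too.
    obtain ⟨M, hM, hMμ⟩ := (hμ.conj σ₁).exists_letter a
    have hstep := List.all_eq_true.1 (List.all_eq_true.1 letters_step M hM) A₁ hA₁
    obtain ⟨A, hA, σ, hσ, h⟩ := someImage_sound hstep
    refine ⟨A, hA, σ.trans σ₁, fun x y => by simp [hσ₁, hσ], fun s hs => ?_⟩
    obtain ⟨s', hs', hconj⟩ := h s hs
    obtain ⟨s₁, hs₁, hc⟩ := List.any_eq_true.1 hs'
    have h2 := h₁ s₁ hs₁
    rw [show a + 1 + 1 + k = a + 1 + (k + 1) by omega] at h2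
    have h3 := completable_step (by omega) hMμ hc h2
    exact h3.conj σ hσ hconj

theorem completable_id {μ : ℕ → Fin 8 → Fin 8} (hμ : IsFibrePairing μ) {a b : ℕ} (hab : a < b) :
    Completable μ a b id := by
  have hid : decode idCode = id := funext decode_idCode
  have hstart := List.all_eq_true.1 letters_start
  simp only [Bool.and_eq_true] at hstart
  by_cases hb : b = a + 1
  · obtain ⟨M, hM, hMμ⟩ := hμ.exists_letter a
    rw [hb, ← hid]
    exact completable_last hMμ (hstart M hM).1
  · obtain ⟨A, hA, σ, hσ, h⟩ := exists_family_completable hμ (b - (a + 2)) (a + 1)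
    obtain ⟨M, hM, hMμ⟩ := (hμ.conj σ).exists_letter a
    obtain ⟨s₁, hs₁, hc⟩ := List.any_eq_true.1 (List.all_eq_true.1 (hstart M hM).2 A hA)
    have h2 := h s₁ hs₁
    rw [show a + 1 + 1 + (b - (a + 2)) = b by omega] at h2
    have h3 := completable_step (by omega) hMμ hc h2
    rw [hid] at h3
    -- The identity state commutes with `σ`, so conjugating back recovers the original `μ`.
    simpa using h3.conj σ.symm (fun x y => by rw [← hσ]; simp) (s' := id) (fun x => rfl)

/-- Every pairing of the product of a path with the cube extends. -/
theorem extendable_slab (k a b : ℕ) (hk : b = a + 1 + k) : Extendable PathCubeAdj (slab a b) := by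
  induction k using Nat.strong_induction_on generalizing a b with
  | _ k ih =>
    intro m hm
    by_cases hcross : ∃ v ∈ slab a b, v.1 < (m v).1
    · obtain ⟨v, hv, hlt⟩ := hcross
      have hmv := mem_slab.1 (hm.map v hv)
      have hv' := mem_slab.1 hv
      -- Cutting just before fibre `c` puts `v` and `m v` on different sides, and both sides are
      -- nonempty and shorter.
      set c := (m v).1
      have hun : slab a b = slab a c ∪ slab c b := by
        ext w
        simp only [Finset.mem_union, mem_slab]
        omega
      have hdis : Disjoint (slab a c) (slab c b) := Finset.disjoint_left.2 fun w h1 h2 => by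
        rw [mem_slab] at h1 h2; omega
      rw [hun] at hm ⊢
      refine extends_of_crossing hdis (ih (c - a - 1) (by omega) a c (by omega))
        (ih (b - c - 1) (by omega) c b (by omega)) ?_ hm
        ⟨v, mem_slab.2 ⟨hv'.1, hlt⟩, mem_slab.2 ⟨le_rfl, hmv.2⟩⟩
      have : (slab a c).card = (c - a) * 8 := by simp [slab]
      rw [this]
      exact Even.mul_left (by decide) _
    · push Not at hcross
      have hfst : ∀ v ∈ slab a b, (m v).1 = v.1 := fun v hv => by
        have h1 := hcross v hv
        have h2 := hcross _ (hm.map v hv)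
        rw [hm.invol v hv] at h2
        omega
      -- `Fin.rev`, an involution of `Fin 8` without fixed points, fills the fibres outside the
      -- slab.
      let μ : ℕ → Fin 8 → Fin 8 := fun i x => if a ≤ i ∧ i < b then (m (i, x)).2 else Fin.rev x
      have hmμ : ∀ v ∈ slab a b, m v = fibrewise μ v := fun v hv => by
        have := mem_slab.1 hv
        exact Prod.ext (hfst v hv) (by simp [fibrewise, μ, this])
      have hμ : IsFibrePairing μ := by
        intro i x
        by_cases hi : a ≤ i ∧ i < b
        · have hv : (i, x) ∈ slab a b := mem_slab.2 hi
          have e1 := hmμ _ hv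
          have e2 := hmμ _ (hm.map _ hv)
          rw [hm.invol _ hv, e1] at e2
          refine ⟨fun h => hm.ne _ hv ?_, (congrArg Prod.snd e2).symm⟩
          rw [e1, fibrewise]
          simp [h]
        · simp only [μ, hi, if_false]
          revert x
          decide
      obtain ⟨n, hn⟩ := completable_id hμ (show a < b by omega)
      refine ⟨n, ⟨hn.map, fun v hv => (hn.adj v hv fun _ => rfl).ne, hn.invol⟩,
        fun v hv => hn.adj v hv fun _ => rfl, fun P h1 h2 => hn.spans P (fun v hv => ?_) h2⟩
      rw [← hmμ v hv]
      exact h1 v hv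

/-! ### Hamiltonian paths in products of a graph with a cycle -/

open SimpleGraph

section Tours

/-- Adjacency of `s` and `t` in the cycle on `{0, …, n - 1}`. -/
def CycleAdj (n s t : ℕ) : Prop :=
  s + 1 = t ∨ t + 1 = s ∨ (s = 0 ∧ t + 1 = n) ∨ (t = 0 ∧ s + 1 = n)

theorem CycleAdj.symm {n s t : ℕ} (h : CycleAdj n s t) : CycleAdj n t s := by
  unfold CycleAdj at *; omega

/-- Adjacency in the product of `G` with the cycle of length `n`. -/
def CycleProductAdj {V : Type*} (G : SimpleGraph V) (n : ℕ) (p q : V × ℕ) : Prop :=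
  (p.1 = q.1 ∧ CycleAdj n p.2 q.2) ∨ (p.2 = q.2 ∧ G.Adj p.1 q.1)

/-- `c` and `d` are consecutive in `L`, in some order. -/
def Consecutive {α : Type*} (L : List α) (c d : α) : Prop := [c, d] <:+: L ∨ [d, c] <:+: L

theorem Consecutive.symm {α : Type*} {L : List α} {c d : α} (h : Consecutive L c d) :
    Consecutive L d c := Or.symm h

theorem Consecutive.mono {α : Type*} {L L' : List α} {c d : α} (h : Consecutive L c d)
    (hL : L <:+: L') : Consecutive L' c d := h.imp (·.trans hL) (·.trans hL)

theorem Consecutive.reverse {α : Type*} {L : List α} {c d : α} (h : Consecutive L c d) :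
    Consecutive L.reverse c d :=
  h.symm.imp (fun h => show [d, c].reverse <:+: L.reverse from List.reverse_infix.2 h)
    fun h => show [c, d].reverse <:+: L.reverse from List.reverse_infix.2 h

theorem Consecutive.map {α β : Type*} {L : List α} {c d : α} (f : α → β) (h : Consecutive L c d) :
    Consecutive (L.map f) (f c) (f d) := h.imp (fun h => h.map f) fun h => h.map f

/-- Any other consecutive pair lies wholly in the part ending at `a` or in the part starting at `b`.
-/
theorem pair_infix_insert {α : Type*} {X Y D : List α} {a b c d : α}
    (h : [c, d] <:+: X ++ a :: b :: Y) (hne : ¬ (c = a ∧ d = b)) :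
    [c, d] <:+: X ++ a :: (D ++ b :: Y) := by
  have e1 : X ++ a :: b :: Y = (X ++ [a]) ++ b :: Y := by simp
  have e2 : X ++ a :: (D ++ b :: Y) = (X ++ [a]) ++ (D ++ b :: Y) := by simp
  rw [e1, List.infix_append_iff] at h
  rw [e2]
  have hl : X ++ [a] <:+: (X ++ [a]) ++ (D ++ b :: Y) := List.infix_append_left
  have hr : b :: Y <:+: (X ++ [a]) ++ (D ++ b :: Y) := by
    rw [← List.append_assoc]; exact List.infix_append_right
  rcases h with h | h | ⟨l₁, l₂, h, h1, h2⟩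
  · exact h.trans hl
  · exact h.trans hr
  · match l₁, h with
    | [], h => 
      have : l₂ = [c, d] := by simpa using h.symm
      subst this
      exact h2.isInfix.trans hr
    | [x], h =>
      have hx : c = x ∧ [d] = l₂ := by simpa using h
      obtain ⟨rfl, rfl⟩ := hx
      exfalso
      apply hne
      constructor
      · have := h1.getLast (by simp)
        simpa using this
      · have := h2.head (by simp)
        simpa using this
    | [x, y], h =>
      have hx : (c = x ∧ d = y) ∧ l₂ = [] := by simpa [and_assoc, eq_comm] using h
      obtain ⟨⟨rfl, rfl⟩, -⟩ := hx
      exact h1.isInfix.trans hl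
    | x :: y :: z :: l, h =>
      have := congrArg List.length h
      simp at this

theorem Consecutive.insert {α : Type*} {X Y D : List α} {a b c d : α}
    (h : Consecutive (X ++ a :: b :: Y) c d) (h1 : ¬ (c = a ∧ d = b)) (h2 : ¬ (d = a ∧ c = b)) :
    Consecutive (X ++ a :: (D ++ b :: Y)) c d :=
  h.imp (fun h => pair_infix_insert h h1) fun h => pair_infix_insert h h2

theorem consecutive_range' {a m s : ℕ} (h1 : a ≤ s) (h2 : s + 1 < a + m) :
    Consecutive (List.range' a m) s (s + 1) := by
  refine Or.inl ⟨List.range' a (s - a), List.range' (s + 2) (a + m - (s + 2)), ?_⟩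
  have e1 : [s, s + 1] = List.range' (a + 1 * (s - a)) 2 := by
    rw [show a + 1 * (s - a) = s by omega]; rfl
  rw [e1, List.range'_append, show s + 2 = a + 1 * (s - a + 2) by omega, List.range'_append]
  congr 1
  omega

/-- The way around the cycle of length `n` from `t` to `t + 1` that avoids this edge. -/
theorem exists_detour {n t : ℕ} (ht : t + 1 < n) : ∃ D : List ℕ, D.Nodup ∧ (∀ s, s ∈ D ↔ s < n) ∧
    D.IsChain (CycleAdj n) ∧ D.head? = some t ∧ D.getLast? = some (t + 1) ∧
    ∀ s, s + 1 < n → s ≠ t → Consecutive D s (s + 1) := by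
  let D₁ := List.range' 0 (t + 1)
  let D₂ := List.range' (t + 1) (n - (t + 1))
  have hch : ∀ a m, (List.range' a m).reverse.IsChain (CycleAdj n) := fun a m => by
    rw [List.isChain_reverse]
    exact (List.isChain_range' a m 1).imp fun x y h => Or.inr (Or.inl h.symm)
  -- The detour is `t, …, 0, n - 1, …, t + 1`, passing from `0` to `n - 1` by the closing edge of
  -- the cycle.
  refine ⟨D₁.reverse ++ D₂.reverse, ?_, ?_, ?_, ?_, ?_, ?_⟩
  · refine List.Nodup.append (List.nodup_reverse.2 List.nodup_range')
      (List.nodup_reverse.2 List.nodup_range') ?_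
    intro s h1 h2
    simp only [D₁, D₂, List.mem_reverse, List.mem_range'_1] at h1 h2
    omega
  · intro s
    simp only [D₁, D₂, List.mem_append, List.mem_reverse, List.mem_range'_1]
    omega
  · refine List.isChain_append.2 ⟨hch _ _, hch _ _, fun x hx y hy => ?_⟩
    rw [List.getLast?_reverse] at hx
    rw [List.head?_reverse, List.getLast?_range'] at hy
    have e1 : D₁.head? = some 0 := by simp [D₁, List.range'_succ]
    rw [e1] at hx
    have e2 : n - (t + 1) ≠ 0 := by omega
    simp [e2] at hx hy
    subst hx hy
    unfold CycleAdj
    omega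
  · rw [List.head?_append, List.head?_reverse]
    simp [D₁, List.getLast?_range']
  · have e : D₂.reverse.getLast? = some (t + 1) := by
      rw [List.getLast?_reverse]
      have : n - (t + 1) = (n - (t + 2)) + 1 := by omega
      simp [D₂, this, List.range'_succ]
    rw [List.getLast?_append, e]
    rfl
  · intro s hs hst
    rcases Nat.lt_or_ge s t with h | h
    · exact (consecutive_range' (a := 0) (m := t + 1) (by omega) (by omega)).reverse.mono
        List.infix_append_left
    · exact (consecutive_range' (a := t + 1) (m := n - (t + 1)) (by omega) (by omega)).reverse.mono
        List.infix_append_right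

variable {V : Type*} [Fintype V] [DecidableEq V]

/-- A Hamiltonian path `L` of the product of `G[A]` with a cycle of length `n`, using many edges
inside every fibre. -/
structure Tour (G : SimpleGraph V) [DecidableRel G.Adj] (n : ℕ) (A : Finset V)
    (L : List (V × ℕ)) : Prop where
  nodup : L.Nodup
  chain : L.IsChain (CycleProductAdj G n)
  mem : ∀ p, p ∈ L ↔ p.1 ∈ A ∧ p.2 < n
  -- A fibre enters with at least `n - 2` such edges and gives up at most one for each neighbour
  -- added later.
  slots : ∀ v ∈ A, ∃ E : Finset ℕ, (∀ t ∈ E, t + 1 < n ∧ Consecutive L (v, t) (v, t + 1)) ∧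
    n ≤ E.card + (G.neighborFinset v ∩ A).card + 2

theorem tour_singleton (G : SimpleGraph V) [DecidableRel G.Adj] (n : ℕ) (v : V) :
    Tour G n {v} ((List.range' 0 n).map fun t => (v, t)) where
  nodup := List.Nodup.map (fun s t h => (Prod.ext_iff.1 h).2) List.nodup_range'
  chain := by
    rw [List.isChain_map]
    exact (List.isChain_range' 0 n 1).imp fun x y h => Or.inl ⟨rfl, Or.inl h.symm⟩
  mem p := by
    simp only [List.mem_map, List.mem_range'_1, Finset.mem_singleton]
    constructor
    · rintro ⟨t, ht, rfl⟩; exact ⟨rfl, by omega⟩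
    · rintro ⟨h1, h2⟩; exact ⟨p.2, by omega, Prod.ext h1.symm rfl⟩
  slots w hw := by
    rw [Finset.mem_singleton.1 hw]
    refine ⟨Finset.range (n - 1), fun t ht => ?_, ?_⟩
    · have := Finset.mem_range.1 ht
      exact ⟨by omega, (consecutive_range' (by omega) (by omega)).map fun t => (v, t)⟩
    · rw [Finset.card_range]; omega

/-- The edge from `(v, x)` to `(v, y)` is replaced by a step to the fibre over `w`, the walk `D`
there, and a step back. -/
theorem Tour.insert_detour {G : SimpleGraph V} [DecidableRel G.Adj] {n : ℕ} {A : Finset V}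
    {X Y : List (V × ℕ)} {v w : V} {x y t : ℕ} (hv : v ∈ A) (hw : w ∉ A) (hvw : G.Adj v w)
    (hT : Tour G n A (X ++ (v, x) :: (v, y) :: Y))
    (hxy : (x = t ∧ y = t + 1) ∨ (x = t + 1 ∧ y = t)) {D : List ℕ} (hD : D.Nodup)
    (hDmem : ∀ s, s ∈ D ↔ s < n) (hDchain : D.IsChain (CycleAdj n)) (hhead : D.head? = some x)
    (hlast : D.getLast? = some y) (hslot : ∀ s, s + 1 < n → s ≠ t → Consecutive D s (s + 1)) :
    Tour G n (insert w A) (X ++ (v, x) :: (D.map (fun s => (w, s)) ++ (v, y) :: Y)) := by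
  have hch := hT.chain
  rw [show X ++ (v, x) :: (v, y) :: Y = (X ++ [(v, x)]) ++ (v, y) :: Y by simp,
    List.isChain_append] at hch
  have hinf : D.map (fun s => (w, s)) <:+: X ++ (v, x) :: (D.map (fun s => (w, s)) ++ (v, y) :: Y) :=
    ⟨X ++ [(v, x)], (v, y) :: Y, by simp⟩
  have hDn : (D.map fun s => (w, s)).Nodup := hD.map fun s t h => (Prod.ext_iff.1 h).2
  have hperm : (X ++ (v, x) :: (D.map (fun s => (w, s)) ++ (v, y) :: Y)).Perm
      (D.map (fun s => (w, s)) ++ (X ++ (v, x) :: (v, y) :: Y)) := by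
    rw [show X ++ (v, x) :: (D.map (fun s => (w, s)) ++ (v, y) :: Y) =
      (X ++ [(v, x)]) ++ (D.map (fun s => (w, s)) ++ (v, y) :: Y) by simp,
      show X ++ (v, x) :: (v, y) :: Y = (X ++ [(v, x)]) ++ (v, y) :: Y by simp]
    exact List.perm_append_comm_assoc _ _ _
  refine ⟨?_, ?_, ?_, ?_⟩
  · rw [hperm.nodup_iff]
    refine hDn.append hT.nodup ?_
    intro p h1 h2
    obtain ⟨s, -, rfl⟩ := List.mem_map.1 h1
    exact hw ((hT.mem _).1 h2).1
  · rw [show X ++ (v, x) :: (D.map (fun s => (w, s)) ++ (v, y) :: Y) =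
      (X ++ [(v, x)]) ++ (D.map (fun s => (w, s)) ++ (v, y) :: Y) by simp,
      List.isChain_append (l₁ := X ++ [(v, x)]),
      List.isChain_append (l₁ := D.map fun s => (w, s))]
    refine ⟨hch.1, ⟨?_, hch.2.1, ?_⟩, ?_⟩
    · rw [List.isChain_map]
      exact hDchain.imp fun s t h => Or.inl ⟨rfl, h⟩
    · intro p hp q hq
      rw [List.getLast?_map, hlast] at hp
      simp at hp hq
      subst hp hq
      exact Or.inr ⟨rfl, hvw.symm⟩
    · intro p hp q hq
      rw [List.head?_append, List.head?_map, hhead] at hq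
      simp at hp hq
      subst hp hq
      exact Or.inr ⟨rfl, hvw⟩
  · intro p
    rw [hperm.mem_iff, List.mem_append, hT.mem, List.mem_map, Finset.mem_insert]
    constructor
    · rintro (⟨s, hs, rfl⟩ | ⟨h1, h2⟩)
      · exact ⟨Or.inl rfl, (hDmem s).1 hs⟩
      · exact ⟨Or.inr h1, h2⟩
    · rintro ⟨h1 | h1, h2⟩
      · exact Or.inl ⟨p.2, (hDmem _).2 h2, Prod.ext h1.symm rfl⟩
      · exact Or.inr ⟨h1, h2⟩
  · intro u hu
    rcases Finset.mem_insert.1 hu with rfl | huA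
    · refine ⟨(Finset.range (n - 1)).erase t, fun s hs => ?_, ?_⟩
      · rw [Finset.mem_erase, Finset.mem_range] at hs
        exact ⟨by omega, ((hslot s (by omega) hs.1).map fun s => (u, s)).mono hinf⟩
      · have := Finset.pred_card_le_card_erase (s := Finset.range (n - 1)) (a := t)
        rw [Finset.card_range] at this
        omega
    · obtain ⟨E, hE, hcard⟩ := hT.slots u huA
      by_cases huv : u = v
      · subst huv
        refine ⟨E.erase t, fun s hs => ?_, ?_⟩
        · rw [Finset.mem_erase] at hs
          refine ⟨(hE s hs.2).1, (hE s hs.2).2.insert ?_ ?_⟩ <;>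
            simp only [Prod.mk.injEq, true_and] <;> omega
        · have h1 := Finset.pred_card_le_card_erase (s := E) (a := t)
          have h2 : (G.neighborFinset u ∩ A).card < (G.neighborFinset u ∩ insert w A).card := by
            refine Finset.card_lt_card (Finset.ssubset_iff_of_subset
              (Finset.inter_subset_inter subset_rfl (Finset.subset_insert _ _)) |>.2 ⟨w, ?_, ?_⟩)
            · simp [hvw]
            · simp [hw]
          omega
      · refine ⟨E, fun s hs => ⟨(hE s hs).1, (hE s hs).2.insert ?_ ?_⟩, hcard.trans ?_⟩
        · simp [huv]
        · simp [huv]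
        · have := Finset.card_le_card
            (Finset.inter_subset_inter (subset_refl (G.neighborFinset u)) (Finset.subset_insert w A))
          omega

/-- As `w` is a neighbour of `v` outside `A`, fewer than `k` neighbours lie in `A`; with `k + 2 ≤ n`
the count leaves a slot over `v`. -/
theorem Tour.exists_insert {G : SimpleGraph V} [DecidableRel G.Adj] {n k : ℕ} {A : Finset V}
    {L : List (V × ℕ)} (hT : Tour G n A L) (hk : k + 2 ≤ n) {v w : V} (hdeg : G.degree v ≤ k)
    (hv : v ∈ A) (hw : w ∉ A) (hvw : G.Adj v w) : ∃ L', Tour G n (insert w A) L' := by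
  obtain ⟨E, hE, hcard⟩ := hT.slots v hv
  have h1 : (G.neighborFinset v ∩ A).card < G.degree v := by
    rw [← G.card_neighborFinset_eq_degree]
    refine Finset.card_lt_card
      ((Finset.ssubset_iff_of_subset Finset.inter_subset_left).2 ⟨w, ?_, ?_⟩)
    · simpa using hvw
    · simp [hw]
  obtain ⟨t, ht⟩ : E.Nonempty := Finset.card_pos.1 (by omega)
  obtain ⟨htn, hcons⟩ := hE t ht
  obtain ⟨D, hD, hmem, hch, hhead, hlast, hslot⟩ := exists_detour htn
  rcases hcons with ⟨X, Y, h⟩ | ⟨X, Y, h⟩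
  · rw [List.append_assoc, List.cons_append, List.cons_append, List.nil_append] at h
    subst h
    exact ⟨_, hT.insert_detour hv hw hvw (Or.inl ⟨rfl, rfl⟩) hD hmem hch hhead hlast hslot⟩
  · rw [List.append_assoc, List.cons_append, List.cons_append, List.nil_append] at h
    subst h
    -- The tour runs from `(v, t + 1)` to `(v, t)` here, so the detour is reversed.
    refine ⟨_, hT.insert_detour (D := D.reverse) hv hw hvw (Or.inr ⟨rfl, rfl⟩)
      (List.nodup_reverse.2 hD) (fun s => by rw [List.mem_reverse, hmem]) ?_ ?_ ?_
      fun s h1 h2 => (hslot s h1 h2).reverse⟩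
    · rw [List.isChain_reverse]; exact hch.imp fun _ _ h => h.symm
    · rw [List.head?_reverse, hlast]
    · rw [List.getLast?_reverse, hhead]

/-- A connected graph of maximum degree at most `k` has a traceable product with every cycle of
length at least `k + 2`. -/
theorem exists_tour {G : SimpleGraph V} [DecidableRel G.Adj] (hG : G.Connected) {n k : ℕ}
    (hk : k + 2 ≤ n) (hdeg : ∀ v, G.degree v ≤ k) : ∃ L, Tour G n Finset.univ L := by
  have key : ∀ j A L, Tour G n A L → A.Nonempty → Aᶜ.card = j →
      ∃ L, Tour G n Finset.univ L := by
    intro j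
    induction j with
    | zero =>
      intro A L hT _ hA
      rw [Finset.card_eq_zero, Finset.compl_eq_empty_iff] at hA
      exact ⟨L, hA ▸ hT⟩
    | succ j ih =>
      intro A L hT hne hA
      obtain ⟨v₀, hv₀⟩ := hne
      obtain ⟨w₀, hw₀⟩ : (Aᶜ).Nonempty := Finset.card_pos.1 (by omega)
      obtain ⟨p⟩ := hG.preconnected v₀ w₀
      obtain ⟨d, -, hd1, hd2⟩ := p.exists_boundary_dart (A : Set V) (by simpa using hv₀)
        (by simpa using hw₀)
      have hd2' : d.snd ∉ A := by simpa using hd2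
      obtain ⟨L', hL'⟩ := hT.exists_insert hk (hdeg d.fst) (by simpa using hd1) hd2' d.adj
      refine ih _ L' hL' ⟨_, Finset.mem_insert_self _ _⟩ ?_
      rw [Finset.compl_insert, Finset.card_erase_of_mem (Finset.mem_compl.2 hd2'), hA]
      rfl
  obtain ⟨v⟩ := hG.nonempty
  exact key _ _ _ (tour_singleton G n v) ⟨v, Finset.mem_singleton_self v⟩ rfl

end Tours

/-! ### Leaves and maximum degree of a tree -/

section Leaves

variable {V : Type*} [Fintype V] (T : SimpleGraph V) [DecidableRel T.Adj]

theorem numLeaves_eq_card : numLeaves T = (Finset.univ.filter fun v => T.degree v = 1).card := by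
  rw [numLeaves, ← Set.ncard_coe_finset]
  congr 1
  ext v
  simp [Set.ncard_eq_toFinset_card', ← card_neighborFinset_eq_degree, neighborFinset]

variable {T} [DecidableEq V]

/-- The degrees sum to `2(|V| - 1)`, while each of the `|V| - 1` vertices other than `v` contributes
at least 2, or 1 if it is a leaf. -/
theorem degree_le_card_leaves_erase [Nontrivial V] (hT : T.IsTree) (v : V) :
    T.degree v ≤ ((Finset.univ.filter fun v => T.degree v = 1).erase v).card := by
  have hsum := T.sum_degrees_eq_twice_card_edges
  have hedges := hT.card_edgeFinset
  have hpos : ∀ u, 0 < T.degree u := fun u => hT.connected.preconnected.degree_pos_of_nontrivial u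
  rw [← Finset.add_sum_erase _ _ (Finset.mem_univ v)] at hsum
  have h1 : ∑ u ∈ Finset.univ.erase v, 2 ≤
      ∑ u ∈ Finset.univ.erase v, (T.degree u + if T.degree u = 1 then 1 else 0) := by
    refine Finset.sum_le_sum fun u _ => ?_
    have := hpos u
    split_ifs <;> omega
  rw [Finset.sum_add_distrib, ← Finset.card_filter, Finset.sum_const, smul_eq_mul,
    Finset.card_erase_of_mem (Finset.mem_univ v), Finset.card_univ] at h1
  have h2 : (Finset.univ.erase v).filter (fun u => T.degree u = 1) =
      (Finset.univ.filter fun v => T.degree v = 1).erase v := by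
    ext u; simp
  rw [h2] at h1
  have := hpos v
  omega

theorem degree_le_numLeaves [Nontrivial V] (hT : T.IsTree) (v : V) :
    T.degree v ≤ numLeaves T := by
  rw [numLeaves_eq_card]
  exact (degree_le_card_leaves_erase hT v).trans (Finset.card_le_card (Finset.erase_subset _ _))

/-- The previous bound does not count the vertex itself: it yields a leaf `u`, and at `u` it yields
another. -/
theorem two_le_numLeaves [Nontrivial V] (hT : T.IsTree) : 2 ≤ numLeaves T := by
  rw [numLeaves_eq_card]
  have hpos : ∀ u, 0 < T.degree u := fun u => hT.connected.preconnected.degree_pos_of_nontrivial u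
  obtain ⟨v⟩ := hT.connected.nonempty
  obtain ⟨u, hu⟩ := Finset.card_pos.1 ((hpos v).trans_le (degree_le_card_leaves_erase hT v))
  have h1 := (hpos u).trans_le (degree_le_card_leaves_erase hT u)
  rw [Finset.card_erase_of_mem (Finset.mem_of_mem_erase hu)] at h1
  omega

end Leaves

/-! ### Gray codes in iterated prisms -/

section Gray

variable {V : Type*} {G : SimpleGraph V}

theorem prism_adj {p q : V × Bool} :
    (prism G).Adj p q ↔ (G.Adj p.1 q.1 ∧ p.2 = q.2) ∨ (p.1 = q.1 ∧ p.2 ≠ q.2) := by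
  rw [prism, boxProd_adj, top_adj]
  tauto

/-- The `t`-th vertex, in the reflected Gray code, of the cube over `v`. -/
def gray : (k : ℕ) → V → ℕ → IterPrismVertex V k
  | 0, v, _ => v
  | k + 1, v, t => if t < 2 ^ k then (gray k v t, false) else (gray k v (2 ^ (k + 1) - 1 - t), true)

theorem gray_succ_of_lt {k t : ℕ} (v : V) (h : t < 2 ^ k) :
    gray (k + 1) v t = (gray k v t, false) := if_pos h

theorem gray_succ_of_ge {k t : ℕ} (v : V) (h : 2 ^ k ≤ t) :
    gray (k + 1) v t = (gray k v (2 ^ (k + 1) - 1 - t), true) := if_neg (by omega)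

/-- The Boolean coordinates of `gray k v t` depend only on `k` and `t`. -/
theorem gray_adj_of_adj {v w : V} (h : G.Adj v w) (k t : ℕ) :
    (iterPrism G k).Adj (gray k v t) (gray k w t) := by
  induction k generalizing t with
  | zero => exact h
  | succ k ih =>
    rcases Nat.lt_or_ge t (2 ^ k) with ht | ht
    · rw [gray_succ_of_lt v ht, gray_succ_of_lt w ht]
      exact prism_adj.2 (Or.inl ⟨ih _, rfl⟩)
    · rw [gray_succ_of_ge v ht, gray_succ_of_ge w ht]
      exact prism_adj.2 (Or.inl ⟨ih _, rfl⟩)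

theorem gray_adj_succ (v : V) (k t : ℕ) (ht : t + 1 < 2 ^ k) :
    (iterPrism G k).Adj (gray k v t) (gray k v (t + 1)) := by
  induction k generalizing t with
  | zero => simp at ht
  | succ k ih =>
    have hpow : 2 ^ (k + 1) = 2 ^ k + 2 ^ k := by ring
    rcases Nat.lt_or_ge (t + 1) (2 ^ k) with h | h
    · rw [gray_succ_of_lt v h, gray_succ_of_lt v (by omega)]
      exact prism_adj.2 (Or.inl ⟨ih _ h, rfl⟩)
    · rcases Nat.lt_or_ge t (2 ^ k) with h' | h'
      -- At the turning point `t + 1 = 2 ^ k` mirrors `t`, so only the last coordinate changes.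
      · rw [gray_succ_of_lt v h', gray_succ_of_ge v h,
          show 2 ^ (k + 1) - 1 - (t + 1) = t by omega]
        exact prism_adj.2 (Or.inr ⟨rfl, by simp⟩)
      · rw [gray_succ_of_ge v h', gray_succ_of_ge v h]
        refine prism_adj.2 (Or.inl ⟨?_, rfl⟩)
        have := (ih (2 ^ (k + 1) - 1 - (t + 1)) (by omega)).symm
        rwa [show 2 ^ (k + 1) - 1 - (t + 1) + 1 = 2 ^ (k + 1) - 1 - t by omega] at this

theorem gray_adj_wrap (v : V) {k : ℕ} (hk : k ≠ 0) :
    (iterPrism G k).Adj (gray k v 0) (gray k v (2 ^ k - 1)) := by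
  obtain ⟨k, rfl⟩ := Nat.exists_eq_succ_of_ne_zero hk
  have hpow : 2 ^ (k + 1) = 2 ^ k + 2 ^ k := by ring
  have hpos : 0 < 2 ^ k := by positivity
  rw [Nat.succ_eq_add_one, gray_succ_of_lt v hpos, gray_succ_of_ge v (by omega), Nat.sub_self]
  exact prism_adj.2 (Or.inr ⟨rfl, by simp⟩)

theorem gray_adj_of_cycleProductAdj {k : ℕ} (hk : k ≠ 0) {p q : V × ℕ} (hp : p.2 < 2 ^ k)
    (hq : q.2 < 2 ^ k) (h : CycleProductAdj G (2 ^ k) p q) :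
    (iterPrism G k).Adj (gray k p.1 p.2) (gray k q.1 q.2) := by
  obtain ⟨v, s⟩ := p
  obtain ⟨w, t⟩ := q
  simp only at hp hq
  rcases h with ⟨h1, h⟩ | ⟨h1, h⟩ <;> simp only at h1 h <;> subst h1
  · rcases h with rfl | rfl | ⟨rfl, h⟩ | ⟨rfl, h⟩
    · exact gray_adj_succ v k s hq
    · exact (gray_adj_succ v k t hp).symm
    · rw [show t = 2 ^ k - 1 by omega]; exact gray_adj_wrap v hk
    · rw [show s = 2 ^ k - 1 by omega]; exact (gray_adj_wrap v hk).symm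
  · exact gray_adj_of_adj h k s

theorem gray_injective {k s t : ℕ} {v w : V} (hs : s < 2 ^ k) (ht : t < 2 ^ k)
    (h : gray k v s = gray k w t) : v = w ∧ s = t := by
  induction k generalizing s t with
  | zero => exact ⟨h, by simp at hs ht; omega⟩
  | succ k ih =>
    have hpow : 2 ^ (k + 1) = 2 ^ k + 2 ^ k := by ring
    rcases Nat.lt_or_ge s (2 ^ k) with h1 | h1 <;> rcases Nat.lt_or_ge t (2 ^ k) with h2 | h2
    · rw [gray_succ_of_lt v h1, gray_succ_of_lt w h2] at h
      exact ih h1 h2 (Prod.ext_iff.1 h).1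
    · rw [gray_succ_of_lt v h1, gray_succ_of_ge w h2] at h
      exact absurd (Prod.ext_iff.1 h).2 (by simp)
    · rw [gray_succ_of_ge v h1, gray_succ_of_lt w h2] at h
      exact absurd (Prod.ext_iff.1 h).2 (by simp)
    · rw [gray_succ_of_ge v h1, gray_succ_of_ge w h2] at h
      have := ih (by omega) (by omega) (Prod.ext_iff.1 h).1
      exact ⟨this.1, by omega⟩

theorem gray_surjective (k : ℕ) (p : IterPrismVertex V k) :
    ∃ v, ∃ t < 2 ^ k, gray k v t = p := by
  induction k with
  | zero => exact ⟨p, 0, by simp, rfl⟩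
  | succ k ih =>
    have hpow : 2 ^ (k + 1) = 2 ^ k + 2 ^ k := by ring
    obtain ⟨p, b⟩ := p
    obtain ⟨v, t, ht, rfl⟩ := ih p
    cases b with
    | false => exact ⟨v, t, by omega, gray_succ_of_lt v ht⟩
    | true =>
      refine ⟨v, 2 ^ (k + 1) - 1 - t, by omega, ?_⟩
      rw [gray_succ_of_ge v (by omega), show 2 ^ (k + 1) - 1 - (2 ^ (k + 1) - 1 - t) = t by omega]

/-- `L` lists the vertices of a Hamiltonian path. -/
structure IsHamiltonianList (G : SimpleGraph V) (L : List V) : Prop where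
  nodup : L.Nodup
  mem : ∀ v, v ∈ L
  chain : L.IsChain G.Adj

/-- This supplies the cycle length needed in `exists_tour`; it fails for `m < 2`, whence the need
for two leaves. -/
theorem add_two_le_two_pow {m : ℕ} (hm : 2 ≤ m) : m + 2 ≤ 2 ^ m := by
  induction m, hm using Nat.le_induction with
  | base => norm_num
  | succ m _ ih => rw [pow_succ]; omega

/-- As many prisms as the minimum leaf number make a connected graph traceable. -/
theorem exists_isHamiltonianList_iterPrism [Finite V] (hG : G.Connected) :
    ∃ L, IsHamiltonianList (iterPrism G (minLeafNumber G)) L := by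
  classical
  have := Fintype.ofFinite V
  obtain ⟨T₀, hT₀, hT₀t⟩ := hG.exists_isTree_le
  obtain ⟨T, hTG, hT, hm⟩ : minLeafNumber G ∈
      {n : ℕ | ∃ T : SimpleGraph V, T ≤ G ∧ T.IsTree ∧ numLeaves T = n} :=
    Nat.sInf_mem ⟨_, T₀, hT₀, hT₀t, rfl⟩
  -- A one-vertex tree has no leaf, so no prism is taken and the path is that vertex.
  obtain hV | hV := subsingleton_or_nontrivial V
  · have h0 : minLeafNumber G = 0 := by
      have : ∀ v, T.degree v = 0 := fun v => by
        rw [← card_neighborFinset_eq_degree, Finset.card_eq_zero, Finset.eq_empty_iff_forall_notMem]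
        intro w hw
        rw [mem_neighborFinset] at hw
        exact hw.ne (Subsingleton.elim _ _)
      rw [← hm, numLeaves_eq_card]
      simp_rw [this]
      simp
    rw [h0]
    obtain ⟨v⟩ := hG.nonempty
    exact ⟨[v], ⟨List.nodup_singleton (α := V) v,
      fun w => List.mem_singleton.2 (hV.elim w v), List.IsChain.singleton (R := G.Adj) v⟩⟩
  · have h2 := two_le_numLeaves hT
    rw [hm] at h2
    obtain ⟨L, hL⟩ := exists_tour hT.connected (add_two_le_two_pow h2)
      fun v => hm ▸ degree_le_numLeaves hT v
    have hlt : ∀ p ∈ L, p.2 < 2 ^ minLeafNumber G := fun p hp => ((hL.mem p).1 hp).2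
    refine ⟨L.map fun p => gray _ p.1 p.2, ⟨?_, fun p => ?_, ?_⟩⟩
    · refine hL.nodup.map_on fun p hp q hq h => ?_
      have := gray_injective (hlt p hp) (hlt q hq) h
      exact Prod.ext this.1 this.2
    · obtain ⟨v, t, ht, rfl⟩ := gray_surjective _ p
      exact List.mem_map.2 ⟨(v, t), (hL.mem _).2 ⟨Finset.mem_univ v, ht⟩, rfl⟩
    · rw [List.isChain_map, List.isChain_iff_getElem]
      intro i hi
      refine gray_adj_of_cycleProductAdj (by omega) (hlt _ (List.getElem_mem _))
        (hlt _ (List.getElem_mem _)) ?_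
      exact (List.isChain_iff_getElem.1 hL.chain i hi).imp id fun h => ⟨h.1, hTG h.2⟩

end Gray

/-! ### Hamiltonian cycles from pairs of involutions -/

section Cycles

variable {V : Type*} {m n : V → V}

/-- The union of two pairings. -/
def unionGraph (m n : V → V) (hm : ∀ v, m v ≠ v) (hn : ∀ v, n v ≠ v) (hmm : ∀ v, m (m v) = v)
    (hnn : ∀ v, n (n v) = v) : SimpleGraph V where
  Adj v w := w = m v ∨ w = n v
  symm.symm v w h := h.imp (fun h => by rw [h, hmm]) fun h => by rw [h, hnn]
  loopless.irrefl v h := h.elim (fun h => hm v h.symm) fun h => hn v h.symm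

/-- The perfect matching of `G` given by an involution along edges. -/
def matchingOf (G : SimpleGraph V) (n : V → V) (hn : ∀ v, G.Adj v (n v))
    (hnn : ∀ v, n (n v) = v) : G.Subgraph where
  verts := Set.univ
  Adj v w := w = n v
  adj_sub := by rintro v _ rfl; exact hn v
  edge_vert _ := Set.mem_univ _
  symm.symm v w h := by rw [h, hnn]

/-- The union of `m` and `n` is 2-regular and connected, hence a single cycle. -/
theorem extends_of_spans [Fintype V] (hV : 2 < Fintype.card V) (G : SimpleGraph V)
    (M : (⊤ : SimpleGraph V).Subgraph) (hM : ∀ v w, M.Adj v w ↔ w = m v)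
    (hmm : ∀ v, m (m v) = v) (hn : ∀ v, G.Adj v (n v)) (hnn : ∀ v, n (n v) = v)
    (hs : Spans Finset.univ m n) : Extends G M := by
  classical
  have hm : ∀ v, m v ≠ v := fun v => (M.adj_sub ((hM v _).2 rfl)).ne'
  -- Otherwise `{v, m v}` is closed under both involutions and, by connectedness, is everything.
  have hne : ∀ v, m v ≠ n v := by
    intro v h
    have key := hs (fun w => w = v ∨ w = m v)
      (fun w _ => ⟨by rintro (rfl | rfl) <;> simp [hmm],
        by rintro (h' | h')
           · right; rw [← h', hmm]
           · left; rw [← hmm w, h', hmm]⟩)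
      (fun w _ => ⟨by rintro (rfl | rfl) <;> simp [h, hnn],
        by rintro (h' | h')
           · right; rw [h, ← h', hnn]
           · left; rw [← hnn w, h', h, hnn]⟩)
      v (Finset.mem_univ _)
    have : (Finset.univ : Finset V) ⊆ {v, m v} := fun w hw => by
      simpa using (key w hw).1 (Or.inl rfl)
    have := (Finset.card_le_card this).trans Finset.card_le_two
    rw [Finset.card_univ] at this
    omega
  let C := unionGraph m n hm (fun v => (hn v).ne') hmm hnn
  have hnbr : ∀ v, C.neighborSet v = {m v, n v} := fun v => by
    ext w; simp [C, unionGraph]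
  have hC : C.IsCycles := fun v _ => by rw [hnbr, Set.ncard_pair (hne v)]
  obtain ⟨v⟩ : Nonempty V := Fintype.card_pos_iff.1 (by omega)
  obtain ⟨p, hp, hverts⟩ := hC.exists_cycle_toSubgraph_verts_eq_connectedComponentSupp
    (c := C.connectedComponentMk v) rfl ⟨m v, by simp [hnbr]⟩
  have hadjm : ∀ w, C.Adj w (m w) := fun w => Or.inl rfl
  have hadjn : ∀ w, C.Adj w (n w) := fun w => Or.inr rfl
  have hreach : ∀ w, C.Reachable v w := fun w =>
    (hs (C.Reachable v) (fun u _ => ⟨fun h => h.trans (hadjm u).reachable,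
        fun h => h.trans (hadjm u).symm.reachable⟩)
      (fun u _ => ⟨fun h => h.trans (hadjn u).reachable,
        fun h => h.trans (hadjn u).symm.reachable⟩)
      v (Finset.mem_univ _) w (Finset.mem_univ _)).1 (Reachable.refl v)
  have hsupp : ∀ w, w ∈ p.support := fun w => by
    rw [← Walk.mem_verts_toSubgraph, hverts, ConnectedComponent.mem_supp_iff]
    exact ConnectedComponent.sound (hreach w).symm
  -- The cycle has two edges at each vertex, so it uses both available ones.
  have hpadj : ∀ w x, p.toSubgraph.Adj w x ↔ x = m w ∨ x = n w := fun w x => by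
    have h1 : p.toSubgraph.neighborSet w ⊆ {m w, n w} :=
      (p.toSubgraph.neighborSet_subset w).trans (hnbr w).subset
    have h2 := Set.eq_of_subset_of_ncard_le h1
      (by rw [hp.ncard_neighborSet_toSubgraph_eq_two (hsupp w), Set.ncard_pair (hne w)])
    exact Set.ext_iff.1 h2 x
  refine ⟨matchingOf G n hn hnn, Subgraph.isPerfectMatching_iff.2 fun w => ⟨n w, rfl, fun _ h => h⟩,
    _, p.mapLe le_top, ?_, ?_⟩
  · rw [Walk.isHamiltonianCycle_iff_isCycle_and_support_count_tail_eq_one]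
    refine ⟨hp.mapLe le_top, fun w => ?_⟩
    rw [Walk.support_mapLe_eq_support]
    refine List.count_eq_one_of_mem hp.support_nodup ?_
    obtain rfl | h := p.mem_support_iff.1 (hsupp w)
    · exact Walk.end_mem_tail_support hp.not_nil
    · exact h
  · rw [Walk.edgeSet_mapLe_eq_edgeSet, ← Walk.edgeSet_toSubgraph]
    ext e
    induction e with
    | _ w x =>
      rw [Set.mem_union, Subgraph.mem_edgeSet, Subgraph.mem_edgeSet, Subgraph.mem_edgeSet,
        hM, hpadj]
      rfl

end Cycles

/-! ### Coordinates on triple prisms of traceable graphs -/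

section TriplePrism

variable {U : Type*}

/-- The `k`-th bit of a vertex of the cube. -/
def bit (x : Fin 8) (k : ℕ) : Bool := x.val.testBit k

/-- The vertex of the cube with the given bits. -/
def corner : Bool → Bool → Bool → Fin 8
  | false, false, false => 0
  | true, false, false => 1
  | false, true, false => 2
  | true, true, false => 3
  | false, false, true => 4
  | true, false, true => 5
  | false, true, true => 6
  | true, true, true => 7

theorem corner_bit : ∀ x, corner (bit x 0) (bit x 1) (bit x 2) = x := by decide

theorem bit_corner : ∀ a b c, bit (corner a b c) 0 = a ∧ bit (corner a b c) 1 = b ∧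
    bit (corner a b c) 2 = c := by decide

theorem CubeAdj.bits : ∀ {x y : Fin 8}, CubeAdj x y →
    (bit x 0 ≠ bit y 0 ∧ bit x 1 = bit y 1 ∧ bit x 2 = bit y 2) ∨
    (bit x 0 = bit y 0 ∧ bit x 1 ≠ bit y 1 ∧ bit x 2 = bit y 2) ∨
    (bit x 0 = bit y 0 ∧ bit x 1 = bit y 1 ∧ bit x 2 ≠ bit y 2) := by
  decide +kernel

/-- The vertex of the triple prism over `u` in the corner `x`. -/
def cornerOver (u : U) (x : Fin 8) : ((U × Bool) × Bool) × Bool :=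
  (((u, bit x 0), bit x 1), bit x 2)

variable {H : SimpleGraph U}

theorem prism_cornerOver_adj_of_cubeAdj (u : U) {x y : Fin 8} (h : CubeAdj x y) :
    (prism (prism (prism H))).Adj (cornerOver u x) (cornerOver u y) := by
  simp only [prism_adj, cornerOver, Prod.mk.injEq, true_and]
  have := h.bits
  tauto

theorem prism_cornerOver_adj_of_adj {u v : U} (h : H.Adj u v) (x : Fin 8) :
    (prism (prism (prism H))).Adj (cornerOver u x) (cornerOver v x) := by
  simp [prism_adj, cornerOver, h]

/-- The triple prism of a traceable graph has the pairing-Hamiltonian property. -/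
theorem IsHamiltonianList.isPH_triple_prism [Nonempty U] {L : List U}
    (hL : IsHamiltonianList H L) : IsPH (prism (prism (prism H))) := by
  classical
  let : Fintype U := ⟨L.toFinset, fun v => List.mem_toFinset.2 (hL.mem v)⟩
  obtain ⟨u₀⟩ := ‹Nonempty U›
  have hpos : 0 < L.length := List.length_pos_of_mem (hL.mem u₀)
  have hcard : Fintype.card (((U × Bool) × Bool) × Bool) = Fintype.card U * 8 := by
    simp only [Fintype.card_prod, Fintype.card_bool]
    ring
  have hU : 0 < Fintype.card U := Fintype.card_pos_iff.2 ⟨u₀⟩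
  -- Positions along `L` serve as path coordinates: `f` and `g` are inverse between the slab and the
  -- triple prism, and the default `u₀` is not reached there.
  let f : ℕ × Fin 8 → ((U × Bool) × Bool) × Bool := fun v => cornerOver (L.getD v.1 u₀) v.2
  let g : ((U × Bool) × Bool) × Bool → ℕ × Fin 8 := fun w =>
    (L.idxOf w.1.1.1, corner w.1.1.2 w.1.2 w.2)
  have hgmem : ∀ w, g w ∈ slab 0 L.length := fun w =>
    mem_slab.2 ⟨Nat.zero_le _, List.idxOf_lt_length_of_mem (hL.mem _)⟩
  have hfg : ∀ w, f (g w) = w := by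
    rintro ⟨⟨⟨u, a⟩, b⟩, c⟩
    have hlt : L.idxOf u < L.length := List.idxOf_lt_length_of_mem (hL.mem _)
    obtain ⟨h0, h1, h2⟩ := bit_corner a b c
    simp only [f, g, cornerOver, h0, h1, h2, List.getD_eq_getElem _ _ hlt, List.getElem_idxOf]
  have hgf : ∀ v ∈ slab 0 L.length, g (f v) = v := by
    rintro ⟨i, x⟩ hv
    have hlt : i < L.length := (mem_slab.1 hv).2
    simp only [f, g, cornerOver, corner_bit, List.getD_eq_getElem _ _ hlt,
      hL.nodup.idxOf_getElem]
  have hstep : ∀ i, i + 1 < L.length → H.Adj (L.getD i u₀) (L.getD (i + 1) u₀) := fun i hi => by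
    rw [List.getD_eq_getElem _ _ hi, List.getD_eq_getElem _ _ (Nat.lt_of_succ_lt hi)]
    exact List.isChain_iff_getElem.1 hL.chain i hi
  have hadj : ∀ v ∈ slab 0 L.length, ∀ w ∈ slab 0 L.length, PathCubeAdj v w →
      (prism (prism (prism H))).Adj (f v) (f w) := by
    rintro ⟨i, x⟩ hv ⟨j, y⟩ hw (⟨h₁, h⟩ | ⟨h₁, h | h⟩) <;>
      dsimp only at h₁ h <;> subst h₁
    · exact prism_cornerOver_adj_of_cubeAdj _ h
    · subst h
      exact prism_cornerOver_adj_of_adj (hstep _ (mem_slab.1 hw).2) _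
    · subst h
      exact (prism_cornerOver_adj_of_adj (hstep _ (mem_slab.1 hv).2) _).symm
  refine ⟨?_, fun M hM => ?_⟩
  · rw [Nat.card_eq_fintype_card, hcard]
    exact Even.mul_left (by decide) _
  rw [Subgraph.isPerfectMatching_iff] at hM
  choose m hMm hm using hM
  have hmm : ∀ v, m (m v) = v := fun v => (hm _ _ (hMm v).symm).symm
  have hpair : IsPairing (slab 0 L.length) fun v => g (m (f v)) :=
    ⟨fun v _ => hgmem _, fun v _ h => (hMm (f v)).ne (by rw [← hfg (m (f v)), h]),
      fun v hv => by simp only [hfg, hmm, hgf v hv]⟩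
  obtain ⟨n, hn, hnadj, hspan⟩ := extendable_slab (L.length - 1) 0 L.length (by omega) _ hpair
  refine extends_of_spans (m := m) (n := fun w => f (n (g w))) (by omega) _ M
    (fun v w => ⟨hm v w, fun h => h ▸ hMm v⟩) hmm (fun w => ?_) (fun w => ?_) ?_
  · have := hadj _ (hgmem w) _ (hn.map _ (hgmem w)) (hnadj _ (hgmem w))
    rwa [hfg] at this
  · simp only [hgf _ (hn.map _ (hgmem w)), hn.invol _ (hgmem w), hfg]
  · intro P h1 h2 u _ v _
    have := hspan (fun x => P (f x))
      (fun x _ => by simpa only [hfg] using h1 (f x) (Finset.mem_univ _))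
      (fun x hx => by simpa only [hgf x hx] using h2 (f x) (Finset.mem_univ _))
      (g u) (hgmem u) (g v) (hgmem v)
    simpa only [hfg] using this

end TriplePrism

end PrismPH

theorem theorem3p3 {V : Type*} [Finite V] (G : SimpleGraph V) (hG : G.Connected)
    (m : ℕ) (hm : m = PrismPH.minLeafNumber G) :
    PrismPH.IsPH (PrismPH.iterPrism G (m + 3)) := by
  subst hm
  obtain ⟨L, hL⟩ := PrismPH.exists_isHamiltonianList_iterPrism hG
  have : Nonempty (PrismPH.IterPrismVertex V (PrismPH.minLeafNumber G)) := by
    induction PrismPH.minLeafNumber G with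
    | zero => exact hG.nonempty
    | succ k ih => exact ih.map fun v => (v, false)
  -- `iterPrism G (m + 3)` unfolds definitionally to the triple prism of `iterPrism G m`.
  exact hL.isPH_triple_prism
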